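/- For positive integers $n$ and $m$, let $g(n,m)$ be the maximum size of a subset of $[n]=\{1,\dots,n\}$ with no subset sum equal to $m$ (a subset sum of $A$ being a sum of distinct elements of $A$). Let $\mathrm{snd}(m)$ be the smallest positive integer that does not divide $m$, and put $$s(n,m)=\left\lfloor \frac{n}{\mathrm{snd}(m)}\right\rfloor+\mathrm{snd}(m)-2 .$$ Let $\log$ be the natural logarithm. Then: (1) There is an absolute constant $C>0$ such that $g(n,m)=s(n,m)$ for all integers $n\ge 2$ and $m\ge 1$ with $$Cn\log n\le m\le \frac{n^2}{12(\log n)^2}.$$ (2) For all positive integers $m$ with $\frac{n^2}{12(\log n)^2}\le m\le\binom{n+1}{2}$, $$g(n,m)=\max\left(s(n,m),(1+o(1))\sqrt{2m}\right),$$ where the $o(1)$ term tends to $0$ as $n\to\infty$, uniformly in $m$. That is, for every $\varepsilon>0$ there is $N\ge 2$ such that for all $n\ge N$ and all such $m$ there is a real $\delta$ with $|\delta|\le\varepsilon$ and $g(n,m)=\max\left(s(n,m),(1+\delta)\sqrt{2m}\right)$. -/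

import Mathlib

/-- `subsetSums A` is the set `Σ(A)` of all sums of distinct elements of `A`
(it contains the empty sum `0`). -/
def subsetSums (A : Finset ℕ) : Finset ℕ :=
  A.powerset.image fun B => ∑ b ∈ B, b

/-- `maxAvoiding n m` is `g(n, m)`, the maximum size of a subset of `{1, …, n}` with no subset sum
equal to `m`. For `m > 0` the family contains `∅`, so the maximum is over a non-empty family. -/
def maxAvoiding (n m : ℕ) : ℕ :=
  ((Finset.Icc 1 n).powerset.filter fun A => m ∉ subsetSums A).sup Finset.card

/-- `smallestNonDivisor m` is `snd(m)`, the smallest positive integer that does not divide `m`.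
It exists, and is at least `2`, for every `m > 0`. -/
noncomputable def smallestNonDivisor (m : ℕ) : ℕ :=
  sInf {d : ℕ | 0 < d ∧ ¬ d ∣ m}

/-- `sBound n m` is `s(n, m) = ⌊n / snd(m)⌋ + snd(m) - 2`. For `m > 0` the subtraction does not
truncate, because `snd(m) ≥ 2`. -/
noncomputable def sBound (n m : ℕ) : ℕ :=
  n / smallestNonDivisor m + smallestNonDivisor m - 2

theorem smallestNonDivisor_isLeast {m : ℕ} (hm : 0 < m) :
    IsLeast {d : ℕ | 0 < d ∧ ¬ d ∣ m} (smallestNonDivisor m) := by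
  have hne : {d : ℕ | 0 < d ∧ ¬ d ∣ m}.Nonempty :=
    ⟨m + 1, Nat.succ_pos m, fun h => absurd (Nat.le_of_dvd hm h) (by omega)⟩
  exact ⟨Nat.sInf_mem hne, fun d hd => Nat.sInf_le hd⟩

theorem two_le_smallestNonDivisor {m : ℕ} (hm : 0 < m) : 2 ≤ smallestNonDivisor m := by
  obtain ⟨h0, h1⟩ := (smallestNonDivisor_isLeast hm).1
  by_contra h
  have h2 : smallestNonDivisor m = 1 := by omega
  exact h1 (h2 ▸ one_dvd m)

/-! Write s = snd(m) and L = log n. Two constructions give the lower bound. The interval {1, …, k}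
with k(k+1)/2 < m has too small a total. The multiples of s, joined by a few elements that are 1 or
-1 mod s, have subset sums that never reach the residue of m mod s (`sBound_le_maxAvoiding`).

For the upper bound, let A have more than s(n,m) elements and at least (1+η)√(2m). Then |A| ≥ n/s,
and s = O(L), so A is dense up to a logarithm. Set aside a small part B of A. The sums of two
elements of B with many representations form a dense set with gcd d = O(L). A growth argument in
ℤ/a, with a the largest such sum, shows that multiples of d in a suitable interval are sums of few
popular sums; the many representations allow the summands to be chosen distinct
(`exists_modulus_of_dense`).

Next let e be the gcd of d and of all elements of A in well populated classes mod d. Only O(L²)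
elements of A escape divisibility by e. A target that is a multiple of e after removal of some
exceptional elements is reached by a greedy sum, a residue correction mod d, and a filling by B
(`exists_divisor_mem_subsetSums`).

It remains to compare e with s (`mem_subsetSums_of_sBound_lt`). If e divides m, no exceptions are
needed. Otherwise e ≥ s. The case e > s would make A smaller than s(n,m). If e = s, there are at
least s-1 non-multiples of s in A, and their subset sums meet the class of m mod s.

The constant 12 in the range of m requires s ≤ 2.39 L, hence a Chebyshev bound ψ(x) ≥ 0.84x - O(1)
for the log of lcm(1, …, x). With it, |A| > s(n,m) already implies |A| ≥ 1.02 √(2m) throughout the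
first range. -/

open scoped Pointwise

/-! ### Growth of sumsets in abelian groups. -/

section SumsetGrowth

variable {G : Type*} [AddCommGroup G] [DecidableEq G]

theorem exists_multiset_of_mem_nsmul {S : Finset G} {n : ℕ} {g : G} (hg : g ∈ n • S) :
    ∃ M : Multiset G, M.card = n ∧ (∀ x ∈ M, x ∈ S) ∧ M.sum = g := by
  induction n generalizing g with
  | zero =>
    rw [zero_nsmul, Finset.mem_zero] at hg
    exact ⟨0, rfl, by simp, by simp [hg]⟩
  | succ k ih =>
    rw [succ_nsmul, Finset.mem_add] at hg
    obtain ⟨y, hy, z, hz, rfl⟩ := hg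
    obtain ⟨M, hM, hMS, rfl⟩ := ih hy
    refine ⟨z ::ₘ M, by simp [hM], ?_, by simp [add_comm]⟩
    intro x hx
    rcases Multiset.mem_cons.1 hx with rfl | hx
    exacts [hz, hMS x hx]

theorem zero_mem_sub_self {S : Finset G} (h0 : (0 : G) ∈ S) : (0 : G) ∈ S - S :=
  Finset.mem_sub.2 ⟨0, h0, 0, h0, sub_zero 0⟩

theorem nsmul_subset_nsmul_of_zero_mem {D : Finset G} (h0 : (0 : G) ∈ D) {i j : ℕ} (hij : i ≤ j) :
    i • D ⊆ j • D :=
  Finset.nsmul_subset_nsmul_right h0 hij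

/-- A ball of `S - S` which does not grow is the subgroup generated by `S`. -/
theorem closure_subset_nsmul_of_stable {S : Finset G} (h0 : (0 : G) ∈ S) {j : ℕ}
    (hst : (j + 1) • (S - S) ⊆ j • (S - S)) {g : G} (hg : g ∈ AddSubgroup.closure (S : Set G)) :
    g ∈ j • (S - S) := by
  have step : ∀ y ∈ j • (S - S), ∀ d ∈ S - S, y + d ∈ j • (S - S) := by
    intro y hy d hd
    have : y + d ∈ (j + 1) • (S - S) := by
      rw [succ_nsmul]
      exact Finset.add_mem_add hy hd
    exact Finset.mem_of_subset hst this
  -- Both signs are carried along so that the negation case of the closure induction is a swap.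
  have key : ∀ y ∈ j • (S - S), y + g ∈ j • (S - S) ∧ y - g ∈ j • (S - S) := by
    generalize j • (S - S) = E at step
    induction hg using AddSubgroup.closure_induction with
    | mem x hx =>
      have hx : x ∈ S := hx
      intro y hy
      refine ⟨step y hy x (Finset.mem_sub.2 ⟨x, hx, 0, h0, sub_zero x⟩), ?_⟩
      rw [sub_eq_add_neg]
      exact step y hy _ (Finset.mem_sub.2 ⟨0, h0, x, hx, zero_sub x⟩)
    | zero => intro y hy; simpa using hy
    | add x z _ _ hx hz =>
      intro y hy
      refine ⟨?_, ?_⟩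
      · rw [← add_assoc]; exact (hz _ (hx y hy).1).1
      · rw [← sub_sub]; exact (hz _ (hx y hy).2).2
    | neg x _ hx =>
      intro y hy
      refine ⟨?_, ?_⟩
      · rw [← sub_eq_add_neg]; exact (hx y hy).2
      · rw [sub_neg_eq_add]; exact (hx y hy).1
  have h00 : (0 : G) ∈ j • (S - S) := by
    have := nsmul_subset_nsmul_of_zero_mem (zero_mem_sub_self h0) (Nat.zero_le j)
    exact Finset.mem_of_subset this (by rw [zero_nsmul]; exact Finset.mem_zero.2 rfl)
  simpa using (key 0 h00).1

theorem mem_closure_of_mem_nsmul_sub {S : Finset G} {j : ℕ} {g : G} (hg : g ∈ j • (S - S)) :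
    g ∈ AddSubgroup.closure (S : Set G) := by
  induction j generalizing g with
  | zero => 
    rw [zero_nsmul, Finset.mem_zero] at hg
    rw [hg]; exact zero_mem _
  | succ k ih =>
    rw [succ_nsmul, Finset.mem_add] at hg
    obtain ⟨y, hy, z, hz, rfl⟩ := hg
    obtain ⟨u, hu, v, hv, rfl⟩ := Finset.mem_sub.1 hz
    exact add_mem (ih hy) (sub_mem (AddSubgroup.subset_closure hu) (AddSubgroup.subset_closure hv))

/-- Balls of `S - S` grow linearly until they fill the subgroup generated by `S`. -/
theorem card_ball_or_full {S K : Finset G} (h0 : (0 : G) ∈ S)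
    (hK : ∀ g, g ∈ K ↔ g ∈ AddSubgroup.closure (S : Set G)) (i : ℕ) :
    (i + 1) * S.card ≤ ((2 * i) • (S - S) + S).card ∨ (2 * i + 1) • (S - S) = K := by
  have hD := zero_mem_sub_self h0
  have full : ∀ j, (j + 1) • (S - S) ⊆ j • (S - S) → ∀ l, j ≤ l → l • (S - S) = K := by
    intro j hj l hl
    ext g
    rw [hK]
    refine ⟨mem_closure_of_mem_nsmul_sub, fun hg => ?_⟩
    exact nsmul_subset_nsmul_of_zero_mem hD hl (closure_subset_nsmul_of_stable h0 hj hg)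
  induction i with
  | zero => left; simp
  | succ i ih =>
    by_cases hst : (2 * i + 1 + 1) • (S - S) ⊆ (2 * i + 1) • (S - S)
    · right
      exact full _ hst _ (by omega)
    · rcases ih with ih | ih
      swap
      · exact absurd (by
          intro g hg
          rw [ih, hK]
          exact mem_closure_of_mem_nsmul_sub hg) hst
      left
      obtain ⟨x, hx, hx'⟩ := Finset.not_subset.1 hst
      -- A common point would place x within one difference of the ball of radius 2i, hence in the
      -- ball of radius 2i+1. So a whole new translate of S is gained.
      have hdisj : Disjoint ((2 * i) • (S - S) + S) ({x} + S) := by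
        rw [Finset.disjoint_left]
        intro z hz hz'
        obtain ⟨y, hy, s, hs, rfl⟩ := Finset.mem_add.1 hz
        obtain ⟨x', hx1, s', hs', he⟩ := Finset.mem_add.1 hz'
        rw [Finset.mem_singleton] at hx1
        subst hx1
        apply hx'
        have : x' = y + (s - s') := by rw [eq_sub_of_add_eq he]; abel
        rw [this, succ_nsmul]
        exact Finset.add_mem_add hy (Finset.sub_mem_sub hs hs')
      have hsub : ((2 * i) • (S - S) + S) ∪ ({x} + S) ⊆ (2 * (i + 1)) • (S - S) + S := by
        apply Finset.union_subset
        · exact Finset.add_subset_add_right (nsmul_subset_nsmul_of_zero_mem hD (by omega))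
        · apply Finset.add_subset_add_right
          rw [Finset.singleton_subset_iff]
          exact hx
      have hc := Finset.card_le_card hsub
      rw [Finset.card_union_of_disjoint hdisj, Finset.singleton_add, Finset.card_vadd_finset] at hc
      nlinarith

theorem card_ball_or_full' {S K : Finset G} (h0 : (0 : G) ∈ S)
    (hK : ∀ g, g ∈ K ↔ g ∈ AddSubgroup.closure (S : Set G)) (i : ℕ) :
    (i + 1) * S.card ≤ ((2 * i + 1) • (S - S)).card ∨ (2 * i + 1) • (S - S) = K := by
  refine (card_ball_or_full h0 hK i).imp_left fun h => h.trans (Finset.card_le_card ?_)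
  rw [succ_nsmul]
  apply Finset.add_subset_add_left
  intro s hs
  exact Finset.mem_sub.2 ⟨s, hs, 0, h0, sub_zero s⟩

/-- `shiftGain X d` is the number of elements of `X + d` outside `X`. -/
def shiftGain (X : Finset G) (d : G) : ℕ := ((d +ᵥ X) \ X).card

theorem shiftGain_add_le (X : Finset G) (d e : G) :
    shiftGain X (d + e) ≤ shiftGain X d + shiftGain X e := by
  unfold shiftGain
  have hsub : ((d + e) +ᵥ X) \ X ⊆ (d +ᵥ ((e +ᵥ X) \ X)) ∪ ((d +ᵥ X) \ X) := by
    intro z hz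
    rw [Finset.mem_sdiff, Finset.mem_vadd_finset] at hz
    obtain ⟨⟨x, hx, rfl⟩, hz⟩ := hz
    rw [Finset.mem_union, Finset.mem_sdiff]
    by_cases hex : e +ᵥ x ∈ X
    · right
      refine ⟨?_, hz⟩
      rw [add_vadd]
      exact Finset.vadd_mem_vadd_finset hex
    · left
      rw [add_vadd]
      exact Finset.vadd_mem_vadd_finset
        (Finset.mem_sdiff.2 ⟨Finset.vadd_mem_vadd_finset hx, hex⟩)
  calc _ ≤ _ := Finset.card_le_card hsub
    _ ≤ _ := Finset.card_union_le _ _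
    _ = _ := by rw [Finset.card_vadd_finset, add_comm]

theorem shiftGain_le_of_mem_nsmul {X D : Finset G} {w : ℕ} (hw : ∀ d ∈ D, shiftGain X d ≤ w)
    {j : ℕ} {g : G} (hg : g ∈ j • D) : shiftGain X g ≤ j * w := by
  induction j generalizing g with
  | zero =>
    rw [zero_nsmul, Finset.mem_zero] at hg
    subst hg
    simp [shiftGain]
  | succ k ih =>
    rw [succ_nsmul, Finset.mem_add] at hg
    obtain ⟨y, hy, z, hz, rfl⟩ := hg
    have := shiftGain_add_le X y z
    have := ih hy
    have := hw z hz
    nlinarith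

/-- A pair (g, x) with x in both g + X and X is determined by (x - g, x), a point of X × X. -/
theorem sum_card_vadd_inter_le (X B : Finset G) :
    ∑ g ∈ B, ((g +ᵥ X) ∩ X).card ≤ X.card * X.card := by
  rw [← Finset.card_product, ← Finset.card_sigma]
  apply Finset.card_le_card_of_injOn (fun p : (_ : G) × G => (-p.1 +ᵥ p.2, p.2))
  · rintro ⟨g, x⟩ hp
    simp only [Finset.coe_sigma, Set.mem_sigma_iff, Finset.mem_coe, Finset.mem_inter] at hp
    simp only [Finset.coe_product, Set.mem_prod, Finset.mem_coe]
    refine ⟨?_, hp.2.2⟩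
    obtain ⟨y, hy, rfl⟩ := Finset.mem_vadd_finset.1 hp.2.1
    simpa using hy
  · rintro ⟨g, x⟩ _ ⟨g', x'⟩ _ h
    simp only [Prod.mk.injEq, vadd_eq_add] at h
    obtain ⟨h1, rfl⟩ := h
    simp only [add_left_inj, neg_inj] at h1
    subst h1
    rfl

/-- Averaging in the manner of Olson. If all differences of S had small gain, subadditivity would
make the gain less than |X|/2 on a ball of at least 2|X| elements. But a translate of X by an
element of that ball meets X, on average, in at most |X|/2 points. -/
theorem exists_shiftGain_ge {S K X : Finset G} (h0 : (0 : G) ∈ S)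
    (hK : ∀ g, g ∈ K ↔ g ∈ AddSubgroup.closure (S : Set G)) (hSX : S.card ≤ X.card)
    (hXK : 2 * X.card ≤ K.card) :
    ∃ s ∈ S, ∃ t ∈ S, S.card ≤ 10 * shiftGain X (s - t) := by
  by_contra! hcon
  have hS : 0 < S.card := Finset.card_pos.2 ⟨0, h0⟩
  set w := (S.card - 1) / 10 with hw
  have hwD : ∀ d ∈ S - S, shiftGain X d ≤ w := by
    intro d hd
    obtain ⟨s, hs, t, ht, rfl⟩ := Finset.mem_sub.1 hd
    have := hcon s hs t ht
    omega
  set i := 2 * X.card / S.card with hi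
  have hball : 2 * X.card ≤ ((2 * i + 1) • (S - S)).card := by
    rcases card_ball_or_full' h0 hK i with h | h
    · refine le_trans ?_ h
      have := Nat.lt_div_mul_add (a := 2 * X.card) hS
      rw [← hi] at this
      nlinarith
    · rw [h]; exact hXK
  set B := (2 * i + 1) • (S - S) with hB
  have hsum : B.card * X.card ≤ X.card * X.card + B.card * ((2 * i + 1) * w) := by
    calc B.card * X.card = ∑ g ∈ B, (((g +ᵥ X) ∩ X).card + shiftGain X g) := by
          rw [Finset.sum_congr rfl (g := fun _ => X.card)]
          · simp
          · intro g _
            unfold shiftGain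
            rw [Finset.card_inter_add_card_sdiff, Finset.card_vadd_finset]
      _ = _ := Finset.sum_add_distrib
      _ ≤ _ := by
          apply add_le_add (sum_card_vadd_inter_le X B)
          apply Finset.sum_le_card_nsmul
          intro g hg
          exact shiftGain_le_of_mem_nsmul hwD hg
  have hX : 0 < X.card := hS.trans_le hSX
  have h1 : X.card ≤ 2 * ((2 * i + 1) * w) := by
    by_contra! h
    have hBpos : 0 < B.card := by omega
    nlinarith
  have h2 : i * S.card ≤ 2 * X.card := Nat.div_mul_le_self _ _
  have h3 : 10 * w < S.card := by omega
  have h4 : 10 * ((2 * i + 1) * w) < (2 * i + 1) * S.card := by nlinarith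
  nlinarith

/-- Each new summand set {s, t} ⊆ S enlarges X by at least |S|/10, since X + {s, t} contains a
translate of X ∪ (X + s - t). This turns growth under differences into growth under sums. -/
theorem exists_large_subset_nsmul {S K : Finset G} (h0 : (0 : G) ∈ S)
    (hK : ∀ g, g ∈ K ↔ g ∈ AddSubgroup.closure (S : Set G)) (k : ℕ) :
    ∃ X ⊆ (k + 1) • S, (10 + k) * S.card ≤ 10 * X.card ∨ K.card < 2 * X.card := by
  suffices h : ∃ X ⊆ (k + 1) • S, S.card ≤ X.card ∧
      ((10 + k) * S.card ≤ 10 * X.card ∨ K.card < 2 * X.card) by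
    obtain ⟨X, h1, _, h2⟩ := h
    exact ⟨X, h1, h2⟩
  induction k with
  | zero => exact ⟨S, by simp, le_rfl, by simp⟩
  | succ k ih =>
    obtain ⟨X, hX, hSX, h⟩ := ih
    by_cases hbig : K.card < 2 * X.card
    · exact ⟨X, hX.trans (nsmul_subset_nsmul_of_zero_mem h0 (by omega)), hSX, Or.inr hbig⟩
    have h := h.resolve_right hbig
    obtain ⟨s, hs, t, ht, hst⟩ := exists_shiftGain_ge h0 hK hSX (not_lt.1 hbig)
    have hcard : (X + {s, t}).card ≥ X.card + shiftGain X (s - t) := by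
      have hsub : t +ᵥ (X ∪ (((s - t) +ᵥ X) \ X)) ⊆ X + {s, t} := by
        intro z hz
        obtain ⟨y, hy, rfl⟩ := Finset.mem_vadd_finset.1 hz
        rw [Finset.mem_union, Finset.mem_sdiff] at hy
        rcases hy with hy | ⟨hy, _⟩
        · rw [vadd_eq_add, add_comm t y]
          exact Finset.add_mem_add hy (by simp)
        · obtain ⟨x, hx, rfl⟩ := Finset.mem_vadd_finset.1 hy
          have : t +ᵥ ((s - t) +ᵥ x) = x + s := by simp only [vadd_eq_add]; abel
          rw [this]
          exact Finset.add_mem_add hx (by simp)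
      have := Finset.card_le_card hsub
      rwa [Finset.card_vadd_finset, Finset.card_union_of_disjoint Finset.disjoint_sdiff] at this
    refine ⟨X + {s, t}, ?_, by omega, Or.inl ?_⟩
    · rw [succ_nsmul (n := k + 1)]
      apply Finset.add_subset_add hX
      intro z hz
      simp only [Finset.mem_insert, Finset.mem_singleton] at hz
      rcases hz with rfl | rfl <;> assumption
    · nlinarith

theorem mem_closure_of_mem_nsmul {S : Finset G} {j : ℕ} {g : G} (hg : g ∈ j • S) :
    g ∈ AddSubgroup.closure (S : Set G) := by
  obtain ⟨M, -, hM, rfl⟩ := exists_multiset_of_mem_nsmul hg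
  exact AddSubgroup.multiset_sum_mem _ _ fun x hx => AddSubgroup.subset_closure (hM x hx)

/-- Every element of the subgroup generated by a finite set `S ∋ 0` is the sum of few elements
of `S`, without subtractions. -/
theorem mem_nsmul_of_mem_closure {S K : Finset G} (h0 : (0 : G) ∈ S)
    (hK : ∀ g, g ∈ K ↔ g ∈ AddSubgroup.closure (S : Set G)) {k : ℕ}
    (hk : 5 * K.card ≤ k * S.card) {g : G} (hg : g ∈ AddSubgroup.closure (S : Set G)) :
    g ∈ (2 * (k + 1)) • S := by
  obtain ⟨X, hX, h⟩ := exists_large_subset_nsmul h0 hK k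
  have hS : 0 < S.card := Finset.card_pos.2 ⟨0, h0⟩
  have hbig : K.card < 2 * X.card := by
    rcases h with h | h
    · nlinarith
    · exact h
  have hXK : X ⊆ K := fun x hx => (hK x).2 (mem_closure_of_mem_nsmul (hX hx))
  have hYK : X.image (fun x => g - x) ⊆ K := by
    intro y hy
    obtain ⟨x, hx, rfl⟩ := Finset.mem_image.1 hy
    exact (hK _).2 (sub_mem hg ((hK x).1 (hXK hx)))
  have hYc : (X.image (fun x => g - x)).card = X.card :=
    Finset.card_image_of_injective _ fun a b hab => by simpa using hab
  -- X and g - X each fill more than half of K, so they meet.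
  have hne : (X ∩ X.image (fun x => g - x)).Nonempty := by
    by_contra hne
    rw [Finset.not_nonempty_iff_eq_empty, ← Finset.disjoint_iff_inter_eq_empty] at hne
    have := Finset.card_le_card (Finset.union_subset hXK hYK)
    rw [Finset.card_union_of_disjoint hne] at this
    omega
  obtain ⟨y, hy⟩ := hne
  rw [Finset.mem_inter, Finset.mem_image] at hy
  obtain ⟨hy, x, hx, rfl⟩ := hy
  have : g = (g - x) + x := by abel
  rw [this, two_mul, add_nsmul]
  exact Finset.add_mem_add (hX hy) (hX hx)

end SumsetGrowth

/-! ### Sums with repetition: residues and the Frobenius problem. -/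

section Frobenius

/-- The preimage in ℤ of the generated subgroup is cyclic; its generator divides a and every element
of S, hence t. -/
theorem natCast_mem_closure {S : Finset ℕ} {a t : ℕ} (h : Nat.gcd a (S.gcd id) ∣ t) :
    (t : ZMod a) ∈ AddSubgroup.closure
      ((insert 0 (S.image (Nat.cast : ℕ → ZMod a)) : Finset (ZMod a)) : Set (ZMod a)) := by
  set C := AddSubgroup.closure
      ((insert 0 (S.image (Nat.cast : ℕ → ZMod a)) : Finset (ZMod a)) : Set (ZMod a)) with hC
  obtain ⟨g, hg⟩ := Int.subgroup_cyclic (C.comap (Int.castAddHom (ZMod a)))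
  have hmem : ∀ z : ℤ, g ∣ z ↔ ((z : ZMod a) ∈ C) := by
    intro z
    rw [← Int.mem_zmultiples_iff, AddSubgroup.zmultiples_eq_closure, ← hg, AddSubgroup.mem_comap]
    rfl
  have ha : g ∣ (a : ℤ) := by
    rw [hmem]
    simp
  have hS : ∀ x ∈ S, g ∣ (x : ℤ) := by
    intro x hx
    rw [hmem]
    apply AddSubgroup.subset_closure
    simp only [Finset.coe_insert, Finset.coe_image, Set.mem_insert_iff, Set.mem_image]
    exact Or.inr ⟨x, hx, by simp⟩
  have hgt : g ∣ (t : ℤ) := by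
    rw [← Int.natAbs_dvd_natAbs] at ha ⊢
    refine dvd_trans (Nat.dvd_gcd ha (Finset.dvd_gcd fun x hx => ?_)) h
    have := hS x hx
    rwa [← Int.natAbs_dvd_natAbs] at this
  have := (hmem _).1 hgt
  simpa using this

theorem exists_multiset_residue {S : Finset ℕ} {a k t : ℕ} (ha : 0 < a)
    (hk : 5 * a ≤ k * (insert 0 (S.image (Nat.cast : ℕ → ZMod a))).card)
    (h : Nat.gcd a (S.gcd id) ∣ t) :
    ∃ M : Multiset ℕ, M.card ≤ 2 * (k + 1) ∧ (∀ x ∈ M, x ∈ S) ∧ (M.sum : ZMod a) = t := by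
  classical
  have : NeZero a := ⟨ha.ne'⟩
  set R : Finset (ZMod a) := insert 0 (S.image (Nat.cast : ℕ → ZMod a)) with hR
  have hmem := natCast_mem_closure h
  rw [← hR] at hmem
  have hcl : (t : ZMod a) ∈ (2 * (k + 1)) • R := by
    refine mem_nsmul_of_mem_closure
      (K := Finset.univ.filter fun g => g ∈ AddSubgroup.closure (R : Set (ZMod a)))
      (by simp [hR]) (by simp) ?_ hmem
    refine le_trans ?_ hk
    have := Finset.card_le_univ
      (Finset.univ.filter fun g => g ∈ AddSubgroup.closure (R : Set (ZMod a)))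
    rw [ZMod.card] at this
    omega
  obtain ⟨M, hMc, hMR, hMs⟩ := exists_multiset_of_mem_nsmul hcl
  have hlift : ∀ M : Multiset (ZMod a), (∀ x ∈ M, x ∈ R) →
      ∃ M' : Multiset ℕ, M'.card ≤ M.card ∧ (∀ x ∈ M', x ∈ S) ∧ (M'.sum : ZMod a) = M.sum := by
    intro M
    induction M using Multiset.induction with
    | empty => intro _; exact ⟨0, by simp⟩
    | cons r M ih =>
      intro hM
      obtain ⟨M', h1, h2, h3⟩ := ih fun x hx => hM x (Multiset.mem_cons_of_mem hx)
      have hr := hM r (Multiset.mem_cons_self r M)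
      rw [hR, Finset.mem_insert, Finset.mem_image] at hr
      rcases hr with rfl | ⟨x, hx, rfl⟩
      · exact ⟨M', by rw [Multiset.card_cons]; omega, h2, by simp [h3]⟩
      · refine ⟨x ::ₘ M', by simpa using h1, ?_, by simp [h3]⟩
        intro y hy
        rcases Multiset.mem_cons.1 hy with rfl | hy
        exacts [hx, h2 y hy]
  obtain ⟨M', h1, h2, h3⟩ := hlift M hMR
  exact ⟨M', by omega, h2, by rw [h3, hMs]⟩

/-- If `a` is the largest element of `S`, every multiple of `gcd S` that is not too small is a sum
of few elements of `S`, repetitions allowed. -/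
theorem exists_multiset_sum_eq {S : Finset ℕ} {a k t : ℕ} (ha : a ∈ S)
    (hS : ∀ x ∈ S, 0 < x ∧ x ≤ a) (hk : 5 * a ≤ k * S.card) (hd : S.gcd id ∣ t)
    (ht : 2 * (k + 1) * a ≤ t) :
    ∃ M : Multiset ℕ, M.card ≤ 2 * (k + 1) + t / a ∧ (∀ x ∈ M, x ∈ S) ∧ M.sum = t := by
  have ha0 := (hS a ha).1
  have hcard : S.card ≤ (insert 0 (S.image (Nat.cast : ℕ → ZMod a))).card := by
    refine le_trans ?_ (Finset.card_le_card (Finset.subset_insert _ _))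
    rw [Finset.card_image_of_injOn]
    intro x hx y hy hxy
    have hx := hS x hx
    have hy := hS y hy
    rw [ZMod.natCast_eq_natCast_iff] at hxy
    have := (Nat.modEq_iff_dvd.1 hxy)
    have h1 : ((y : ℤ) - x).natAbs < a := by omega
    have := Int.eq_zero_of_abs_lt_dvd this (by rw [Int.abs_eq_natAbs]; exact_mod_cast h1)
    omega
  obtain ⟨M, hMc, hMS, hMs⟩ := exists_multiset_residue (S := S) (t := t) ha0
    (hk.trans (Nat.mul_le_mul_left k hcard)) ((Nat.gcd_dvd_right _ _).trans hd)
  have hle : M.sum ≤ t := by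
    have := Multiset.sum_le_card_nsmul M a fun x hx => (hS x (hMS x hx)).2
    rw [smul_eq_mul] at this
    nlinarith
  rw [ZMod.natCast_eq_natCast_iff, Nat.modEq_iff_dvd' hle] at hMs
  obtain ⟨c, hc⟩ := hMs
  -- M has the right residue mod a and does not exceed t, so the deficit is paid in copies of a.
  refine ⟨M + Multiset.replicate c a, ?_, ?_, ?_⟩
  · rw [Multiset.card_add, Multiset.card_replicate]
    have : c ≤ t / a := by
      rw [Nat.le_div_iff_mul_le ha0]
      nlinarith [Nat.sub_le t M.sum]
    omega
  · intro x hx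
    rcases Multiset.mem_add.1 hx with hx | hx
    · exact hMS x hx
    · rw [Multiset.eq_of_mem_replicate hx]; exact ha
  · rw [Multiset.sum_add, Multiset.sum_replicate, smul_eq_mul, mul_comm]
    omega

end Frobenius

/-! ### Sums of two elements with many representations. -/

section PopularSums

/-- The ordered pairs of distinct elements of `B` with sum `x`. -/
def sumPairs (B : Finset ℕ) (x : ℕ) : Finset (ℕ × ℕ) :=
  B.offDiag.filter fun p => p.1 + p.2 = x

/-- The integers with at least `T` representations as a sum of two distinct elements of `B`. -/
def popularSums (B : Finset ℕ) (T : ℕ) : Finset ℕ :=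
  (B.offDiag.image fun p => p.1 + p.2).filter fun x => T ≤ (sumPairs B x).card

theorem card_sumPairs_le (B : Finset ℕ) (x : ℕ) : (sumPairs B x).card ≤ B.card := by
  apply Finset.card_le_card_of_injOn Prod.fst
  · intro p hp
    simp only [sumPairs, Finset.coe_filter, Finset.mem_offDiag, Set.mem_ofPred_eq] at hp
    exact hp.1.1
  · rintro ⟨a, b⟩ hp ⟨c, d⟩ hq h
    simp only [sumPairs, Finset.coe_filter, Finset.mem_offDiag, Set.mem_ofPred_eq] at hp hq h
    ext <;> simp <;> omega

theorem mem_popularSums_bounds {B : Finset ℕ} {n T x : ℕ} (hB : B ⊆ Finset.Icc 1 n)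
    (hx : x ∈ popularSums B T) : 0 < x ∧ x ≤ 2 * n := by
  simp only [popularSums, Finset.mem_filter, Finset.mem_image, Finset.mem_offDiag] at hx
  obtain ⟨⟨p, ⟨h1, h2, -⟩, rfl⟩, -⟩ := hx
  have h1 := Finset.mem_Icc.1 (hB h1)
  have h2 := Finset.mem_Icc.1 (hB h2)
  omega

/-- Unpopular sums account for at most 2nT ≤ |B|²/4 of the |B|² - |B| pairs, and a popular sum for
at most |B|. -/
theorem card_le_two_mul_card_popularSums {B : Finset ℕ} {n T : ℕ} (hB : B ⊆ Finset.Icc 1 n)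
    (h4 : 4 ≤ B.card) (hT : 8 * n * T ≤ B.card ^ 2) :
    B.card ≤ 2 * (popularSums B T).card := by
  set I := B.offDiag.image fun p => p.1 + p.2 with hI
  have hIcard : I.card ≤ 2 * n := by
    have : I ⊆ Finset.Icc 1 (2 * n) := by
      intro x hx
      obtain ⟨p, hp, rfl⟩ := Finset.mem_image.1 hx
      rw [Finset.mem_offDiag] at hp
      have h1 := Finset.mem_Icc.1 (hB hp.1)
      have h2 := Finset.mem_Icc.1 (hB hp.2.1)
      rw [Finset.mem_Icc]
      omega
    simpa using Finset.card_le_card this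
  have hsum : B.offDiag.card = ∑ x ∈ I, (sumPairs B x).card :=
    Finset.card_eq_sum_card_image _ _
  have hsplit : ∑ x ∈ I, (sumPairs B x).card ≤
      (popularSums B T).card * B.card + 2 * n * T := by
    rw [← Finset.sum_filter_add_sum_filter_not I fun x => T ≤ (sumPairs B x).card]
    apply add_le_add
    · rw [← smul_eq_mul]
      exact Finset.sum_le_card_nsmul _ _ _ fun x _ => card_sumPairs_le B x
    · calc _ ≤ (I.filter fun x => ¬ T ≤ (sumPairs B x).card).card • T := by
            apply Finset.sum_le_card_nsmul
            intro x hx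
            exact (not_le.1 (Finset.mem_filter.1 hx).2).le
        _ ≤ _ := by
            rw [smul_eq_mul]
            exact Nat.mul_le_mul_right _ ((Finset.card_filter_le _ _).trans hIcard)
  rw [← hsum, Finset.offDiag_card] at hsplit
  have h1 : B.card * B.card ≤ (popularSums B T).card * B.card + 2 * n * T + B.card := by omega
  by_contra! hcon
  nlinarith

/-- Each element of U spoils at most two ordered pairs with a given sum. -/
theorem exists_sumPair_avoiding {B U : Finset ℕ} {x : ℕ}
    (h : 2 * U.card < (sumPairs B x).card) :
    ∃ b ∈ B, ∃ c ∈ B, b ≠ c ∧ b + c = x ∧ b ∉ U ∧ c ∉ U := by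
  by_contra! hcon
  have hsub : sumPairs B x ⊆ U.image (fun u => (u, x - u)) ∪ U.image (fun u => (x - u, u)) := by
    rintro ⟨b, c⟩ hp
    simp only [sumPairs, Finset.mem_filter, Finset.mem_offDiag] at hp
    obtain ⟨⟨hb, hc, hbc⟩, hx⟩ := hp
    simp only [Finset.mem_union, Finset.mem_image, Prod.mk.injEq]
    by_cases hbU : b ∈ U
    · exact Or.inl ⟨b, hbU, rfl, by omega⟩
    · exact Or.inr ⟨c, hcon b hb c hc hbc hx hbU, by omega, rfl⟩
  have h1 := Finset.card_le_card hsub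
  have h2 := Finset.card_union_le (U.image (fun u => (u, x - u))) (U.image (fun u => (x - u, u)))
  have h3 : (U.image (fun u => (u, x - u))).card ≤ U.card := Finset.card_image_le
  have h4 : (U.image (fun u => (x - u, u))).card ≤ U.card := Finset.card_image_le
  omega

/-- A sum of few popular sums of `B` is a sum of distinct elements of `B` outside a given small
set `U`. -/
theorem exists_subset_sum_eq_multiset_sum {B : Finset ℕ} {T : ℕ} (M : Multiset ℕ)
    (hM : ∀ x ∈ M, x ∈ popularSums B T) (U : Finset ℕ) (hU : 2 * (U.card + 2 * M.card) < T) :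
    ∃ W ⊆ B, Disjoint W U ∧ ∑ w ∈ W, w = M.sum := by
  induction M using Multiset.induction generalizing U with
  | empty => exact ⟨∅, by simp⟩
  | cons x M ih =>
    rw [Multiset.card_cons] at hU
    have hx := hM x (Multiset.mem_cons_self x M)
    have hxT : T ≤ (sumPairs B x).card := (Finset.mem_filter.1 hx).2
    obtain ⟨b, hb, c, hc, hbc, rfl, hbU, hcU⟩ :=
      exists_sumPair_avoiding (B := B) (U := U) (x := x) (by omega)
    obtain ⟨W, hWB, hWU, hW⟩ := ih (fun y hy => hM y (Multiset.mem_cons_of_mem hy))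
      (insert b (insert c U)) (by
        have h1 := Finset.card_insert_le b (insert c U)
        have h2 := Finset.card_insert_le c U
        omega)
    rw [Finset.disjoint_insert_right, Finset.disjoint_insert_right] at hWU
    obtain ⟨hbW, hcW, hWU⟩ := hWU
    refine ⟨insert b (insert c W), ?_, ?_, ?_⟩
    · simp [Finset.insert_subset_iff, hb, hc, hWB]
    · simp [hbU, hcU, hWU]
    · rw [Finset.sum_insert (by simp [hbc, hbW]), Finset.sum_insert hcW, hW, Multiset.sum_cons]
      ring

end PopularSums

/-! ### Structure of the subset sums of a dense set. -/

section SubsetSumStructure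

theorem mem_subsetSums {A : Finset ℕ} {m : ℕ} : m ∈ subsetSums A ↔ ∃ B ⊆ A, ∑ b ∈ B, b = m := by
  simp [subsetSums]

theorem exists_subset_sum_near {Q : Finset ℕ} {n y : ℕ} (hQ : ∀ x ∈ Q, x ≤ n)
    (hy : y ≤ ∑ x ∈ Q, x) : ∃ R ⊆ Q, ∑ x ∈ R, x ≤ y ∧ y ≤ ∑ x ∈ R, x + n := by
  induction Q using Finset.induction_on with
  | empty => exact ⟨∅, le_rfl, by simp, by simpa using le_trans hy (Nat.zero_le _)⟩
  | insert x Q hx ih =>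
    by_cases h : y ≤ ∑ x ∈ Q, x
    · obtain ⟨R, hR, h1⟩ := ih (fun z hz => hQ z (Finset.mem_insert_of_mem hz)) h
      exact ⟨R, hR.trans (Finset.subset_insert _ _), h1⟩
    · rw [Finset.sum_insert hx] at hy
      have := hQ x (Finset.mem_insert_self x Q)
      exact ⟨Q, Finset.subset_insert _ _, by omega, by omega⟩

theorem card_sq_le_two_mul_sum {Q : Finset ℕ} (hQ : ∀ x ∈ Q, 0 < x) :
    Q.card ^ 2 ≤ 2 * ∑ x ∈ Q, x := by
  induction Q using Finset.induction_on_max with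
  | empty => simp
  | insert a Q hmax ih =>
    have ha : a ∉ Q := fun h => lt_irrefl _ (hmax a h)
    have ih := ih fun x hx => hQ x (Finset.mem_insert_of_mem hx)
    have hsub : Q ⊆ Finset.Ico 1 a := fun x hx => by
      have := hQ x (Finset.mem_insert_of_mem hx)
      have := hmax x hx
      rw [Finset.mem_Ico]
      omega
    have hc := Finset.card_le_card hsub
    rw [Nat.card_Ico] at hc
    have := hQ a (Finset.mem_insert_self a Q)
    rw [Finset.card_insert_of_notMem ha, Finset.sum_insert ha]
    have : Q.card + 1 ≤ a := by omega
    nlinarith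

/-- The elements of `A` whose residue class modulo `d` contains at least `K` elements of `A`. -/
def popularPart (A : Finset ℕ) (d K : ℕ) : Finset ℕ :=
  A.filter fun x => K ≤ (A.filter fun y => y % d = x % d).card

theorem card_sdiff_popularPart_le (A : Finset ℕ) {d : ℕ} (hd : 0 < d) (K : ℕ) :
    (A \ popularPart A d K).card ≤ d * K := by
  have := Finset.card_le_mul_card_image_of_maps_to (s := A \ popularPart A d K)
    (f := fun x => x % d) (t := Finset.range d)
    (fun x _ => Finset.mem_range.2 (Nat.mod_lt x hd)) K (by
      intro r _
      rcases ((A \ popularPart A d K).filter fun x => x % d = r).eq_empty_or_nonempty with h | ⟨x, hx⟩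
      · rw [h]; simp
      · rw [Finset.mem_filter, Finset.mem_sdiff, popularPart, Finset.mem_filter] at hx
        obtain ⟨⟨hxA, hx⟩, rfl⟩ := hx
        have h1 : (A.filter fun y => y % d = x % d).card < K := by
          by_contra! h
          exact hx ⟨hxA, h⟩
        exact (Finset.card_le_card (Finset.filter_subset_filter _ Finset.sdiff_subset)).trans h1.le)
  rwa [Finset.card_range, mul_comm] at this

/-- K elements of each popular class suffice, and there are at most d classes. -/
theorem exists_reserve (A : Finset ℕ) {d : ℕ} (hd : 0 < d) (K : ℕ) :
    ∃ P ⊆ popularPart A d K, P.card ≤ d * K ∧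
      ∀ x ∈ popularPart A d K, K ≤ (P.filter fun y => y % d = x % d).card := by
  have hex : ∀ r, ∃ R ⊆ popularPart A d K, R.card ≤ K ∧
      ∀ x ∈ popularPart A d K, x % d = r → K ≤ (R.filter fun y => y % d = x % d).card := by
    intro r
    by_cases h : K ≤ (A.filter fun y => y % d = r).card
    · obtain ⟨R, hR, hRK⟩ := Finset.exists_subset_card_eq h
      refine ⟨R, ?_, hRK.le, ?_⟩
      · intro x hx
        have := Finset.mem_filter.1 (hR hx)
        rw [popularPart, Finset.mem_filter]
        refine ⟨this.1, ?_⟩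
        rw [this.2]
        exact h
      · rintro x _ rfl
        rw [Finset.filter_true_of_mem, hRK]
        exact fun y hy => (Finset.mem_filter.1 (hR hy)).2
    · refine ⟨∅, by simp, by simp, ?_⟩
      rintro x hx rfl
      exact absurd (Finset.mem_filter.1 hx).2 h
  choose R h1 h2 h3 using hex
  refine ⟨(Finset.range d).biUnion R, Finset.biUnion_subset.2 fun r _ => h1 r, ?_, ?_⟩
  · calc _ ≤ ∑ r ∈ Finset.range d, (R r).card := Finset.card_biUnion_le
      _ ≤ (Finset.range d).card • K := Finset.sum_le_card_nsmul _ _ _ fun r _ => h2 r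
      _ = d * K := by simp
  · intro x hx
    refine (h3 (x % d) x hx rfl).trans (Finset.card_le_card (Finset.filter_subset_filter _ ?_))
    exact Finset.subset_biUnion_of_mem R (Finset.mem_range.2 (Nat.mod_lt x hd))

/-- Repeated terms of M are replaced by distinct members of the same residue class. -/
theorem exists_subset_sum_modEq {P : Finset ℕ} {d K : ℕ} (M : Multiset ℕ)
    (hM : ∀ x ∈ M, K ≤ (P.filter fun y => y % d = x % d).card) (U : Finset ℕ)
    (hU : U.card + M.card ≤ K) :
    ∃ W ⊆ P, Disjoint W U ∧ W.card ≤ M.card ∧ ∑ w ∈ W, w ≡ M.sum [MOD d] := by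
  induction M using Multiset.induction generalizing U with
  | empty => exact ⟨∅, by simp [Nat.ModEq.refl]⟩
  | cons x M ih =>
    rw [Multiset.card_cons] at hU
    have hx := hM x (Multiset.mem_cons_self x M)
    obtain ⟨y, hy, hyU⟩ := Finset.exists_mem_notMem_of_card_lt_card
      (s := U) (t := P.filter fun y => y % d = x % d) (by omega)
    rw [Finset.mem_filter] at hy
    obtain ⟨W, hWP, hWU, hWc, hW⟩ := ih (fun z hz => hM z (Multiset.mem_cons_of_mem hz))
      (insert y U) (by
        have := Finset.card_insert_le y U
        omega)
    rw [Finset.disjoint_insert_right] at hWU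
    refine ⟨insert y W, ?_, ?_, ?_, ?_⟩
    · simp [Finset.insert_subset_iff, hy.1, hWP]
    · simp [hyU, hWU.2]
    · rw [Multiset.card_cons, Finset.card_insert_of_notMem hWU.1]
      omega
    · rw [Finset.sum_insert hWU.1, Multiset.sum_cons]
      exact Nat.ModEq.add hy.2 hW

theorem card_mul_gcd_le {S : Finset ℕ} {a : ℕ} (hS : ∀ x ∈ S, 0 < x ∧ x ≤ a)
    (hd : 0 < S.gcd id) : S.card * S.gcd id ≤ a := by
  rw [← Nat.le_div_iff_mul_le hd]
  have : S.card ≤ (Finset.Icc 1 (a / S.gcd id)).card := by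
    apply Finset.card_le_card_of_injOn (fun x => x / S.gcd id)
    · intro x hx
      have hdx : S.gcd id ∣ x := Finset.gcd_dvd (f := id) hx
      have := hS x hx
      simp only [Finset.coe_Icc, Set.mem_Icc]
      exact ⟨Nat.div_pos (Nat.le_of_dvd this.1 hdx) hd, Nat.div_le_div_right this.2⟩
    · intro x hx y hy h
      have hdx : S.gcd id ∣ x := Finset.gcd_dvd (f := id) hx
      have hdy : S.gcd id ∣ y := Finset.gcd_dvd (f := id) hy
      rw [← Nat.div_mul_cancel hdx, ← Nat.div_mul_cancel hdy]
      simp only at h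
      rw [h]
  simpa using this

/-- The gcd of the popular sums of a dense set `B ⊆ {1, …, n}` is bounded, and multiples of it in a
suitable interval are sums of distinct elements of `B` that avoid a given small set. -/
theorem exists_modulus_of_dense {n κ : ℕ} (hn1 : 0 < n) {B : Finset ℕ} (hB : B ⊆ Finset.Icc 1 n)
    (hκ : n ≤ κ * B.card) (hn : 20000 * κ ^ 4 ≤ n) :
    ∃ d : ℕ, 0 < d ∧ d ≤ 4 * κ ∧ ∀ t : ℕ, d ∣ t → 84 * κ * n ≤ t → t ≤ 127 * κ * n →
      ∀ U : Finset ℕ, U.card ≤ 336 * κ ^ 2 → ∃ W ⊆ B, Disjoint W U ∧ ∑ w ∈ W, w = t := by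
  have hκ0 : 0 < κ := by
    rcases Nat.eq_zero_or_pos κ with h | h
    · subst h; omega
    · exact h
  have hβ : 20000 * κ ^ 3 ≤ B.card := by
    have : κ * (20000 * κ ^ 3) ≤ κ * B.card := by
      calc κ * (20000 * κ ^ 3) = 20000 * κ ^ 4 := by ring
        _ ≤ _ := hn.trans hκ
    exact Nat.le_of_mul_le_mul_left this hκ0
  have hκ3 : 1 ≤ κ ^ 3 := Nat.one_le_pow _ _ hκ0
  -- At most 42κ² + 254κ² = 296κ² popular sums are used while 336κ² elements are avoided, and 2(336
  -- + 2·296) = 1856.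
  set T := 1857 * κ ^ 2 with hTdef
  have hT : 8 * n * T ≤ B.card ^ 2 := by
    calc 8 * n * T = 14856 * κ ^ 2 * n := by rw [hTdef]; ring
      _ ≤ 14856 * κ ^ 2 * (κ * B.card) := Nat.mul_le_mul_left _ hκ
      _ = (14856 * κ ^ 3) * B.card := by ring
      _ ≤ B.card * B.card := Nat.mul_le_mul_right _ (by omega)
      _ = _ := by ring
  have hBS := card_le_two_mul_card_popularSums hB (by omega) hT
  set S := popularSums B T with hS
  have hSne : S.Nonempty := by
    rw [← Finset.card_pos]
    omega
  set a := S.max' hSne with ha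
  have haS : a ∈ S := Finset.max'_mem _ _
  have hSa : ∀ x ∈ S, 0 < x ∧ x ≤ a := fun x hx =>
    ⟨(mem_popularSums_bounds hB hx).1, Finset.le_max' _ _ hx⟩
  have ha0 := (hSa a haS).1
  have ha2 : a ≤ 2 * n := (mem_popularSums_bounds hB haS).2
  have hd0 : 0 < S.gcd id := Nat.pos_of_ne_zero fun h => by
    rw [Finset.gcd_eq_zero_iff] at h
    exact ha0.ne' (h a haS)
  have hdS := card_mul_gcd_le hSa hd0
  have hSle : S.card ≤ a := le_trans (Nat.le_mul_of_pos_right _ hd0) hdS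
  refine ⟨S.gcd id, hd0, ?_, ?_⟩
  · have h1 : B.card * S.gcd id ≤ B.card * (4 * κ) := by nlinarith
    exact Nat.le_of_mul_le_mul_left h1 (by omega)
  · intro t hdt ht1 ht2 U hU
    obtain ⟨M, hMc, hMS, hMt⟩ := exists_multiset_sum_eq (k := 20 * κ) haS hSa
      (by nlinarith) hdt (by
        calc 2 * (20 * κ + 1) * a ≤ (42 * κ) * (2 * n) := Nat.mul_le_mul (by omega) ha2
          _ = 84 * κ * n := by ring
          _ ≤ t := ht1)
    have hta : t / a ≤ 254 * κ ^ 2 := by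
      apply Nat.div_le_of_le_mul
      calc t ≤ 127 * κ * n := ht2
        _ ≤ 127 * κ * (κ * B.card) := Nat.mul_le_mul_left _ hκ
        _ ≤ 127 * κ * (κ * (2 * a)) := by gcongr; omega
        _ = a * (254 * κ ^ 2) := by ring
    have hκ2 : κ ≤ κ ^ 2 := Nat.le_self_pow (by norm_num) κ
    obtain ⟨W, h1, h2, h3⟩ := exists_subset_sum_eq_multiset_sum M hMS U (by omega)
    exact ⟨W, h1, h2, h3.trans hMt⟩

/-- Structure of the subset sums of a dense set: up to few exceptions all elements of `A` are
multiples of some `e`, and all large multiples of `e`, up to nearly `∑ A`, are subset sums. -/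
theorem exists_divisor_mem_subsetSums {n κ : ℕ} (hn1 : 0 < n) {A B : Finset ℕ} (hBA : B ⊆ A)
    (hA : A ⊆ Finset.Icc 1 n) (hκ : n ≤ κ * B.card) (hn : 20000 * κ ^ 4 ≤ n) :
    ∃ e : ℕ, 0 < e ∧ (A.filter fun x => ¬ e ∣ x).card ≤ 168 * κ ^ 2 ∧
      ∀ F ⊆ A.filter (fun x => ¬ e ∣ x), ∀ q m : ℕ, q + B.card + 336 * κ ^ 2 ≤ A.card →
        2 * m ≤ q ^ 2 → ∑ x ∈ F, x + 126 * κ * n ≤ m → e ∣ m - ∑ x ∈ F, x →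
        m ∈ subsetSums A := by
  have hκ0 : 0 < κ := by
    rcases Nat.eq_zero_or_pos κ with h | h
    · subst h; omega
    · exact h
  obtain ⟨d, hd0, hdκ, hrep⟩ := exists_modulus_of_dense hn1 (hBA.trans hA) hκ hn
  -- The residue correction below uses at most 2(20κ+1) ≤ 42κ terms.
  set K := 42 * κ with hK
  have hdK : d * K ≤ 168 * κ ^ 2 := by rw [hK]; nlinarith
  set V := popularPart A d K with hV
  set e := Nat.gcd d (V.gcd id) with he
  have heV : ∀ x ∈ V, e ∣ x := fun x hx =>
    (Nat.gcd_dvd_right _ _).trans (Finset.gcd_dvd (f := id) hx)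
  set E := A.filter (fun x => ¬ e ∣ x) with hE
  have hEc : E.card ≤ 168 * κ ^ 2 := by
    refine le_trans (Finset.card_le_card ?_) ((card_sdiff_popularPart_le A hd0 K).trans hdK)
    intro x hx
    rw [hE, Finset.mem_filter] at hx
    exact Finset.mem_sdiff.2 ⟨hx.1, fun h => hx.2 (heV x h)⟩
  obtain ⟨P, hPV, hPc, hP⟩ := exists_reserve A hd0 K
  have hPA : P ⊆ A := hPV.trans (Finset.filter_subset _ _)
  have hnA : ∀ x ∈ A, 0 < x ∧ x ≤ n := fun x hx => by
    have := Finset.mem_Icc.1 (hA hx)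
    omega
  refine ⟨e, Nat.gcd_pos_of_pos_left _ hd0, hEc, ?_⟩
  intro F hF q m hq hm hlow hdvd
  set Q := A \ (E ∪ B ∪ P) with hQ
  have hQA : Q ⊆ A := Finset.sdiff_subset
  have hQc : q ≤ Q.card := by
    have h1 := Finset.le_card_sdiff (E ∪ B ∪ P) A
    rw [← hQ] at h1
    have h2 := Finset.card_union_le (E ∪ B) P
    have h3 := Finset.card_union_le E B
    omega
  have hQe : ∀ x ∈ Q, e ∣ x := by
    intro x hx
    rw [hQ, Finset.mem_sdiff, Finset.mem_union, Finset.mem_union] at hx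
    by_contra h
    exact hx.2 (Or.inl (Or.inl (Finset.mem_filter.2 ⟨hx.1, h⟩)))
  have hQs : m ≤ ∑ x ∈ Q, x := by
    have h1 := card_sq_le_two_mul_sum fun x hx => (hnA x (hQA hx)).1
    have h2 : q ^ 2 ≤ Q.card ^ 2 := Nat.pow_le_pow_left hQc 2
    omega
  set f := ∑ x ∈ F, x with hf
  -- The greedy sum leaves between 126κn and 127κn. The correction W then costs at most 42κn, so the
  -- rest lies in the interval served by B.
  obtain ⟨R, hRQ, hR1, hR2⟩ := exists_subset_sum_near (y := m - f - 126 * κ * n)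
    (fun x hx => (hnA x (hQA hx)).2) (by omega)
  set r := ∑ x ∈ R, x with hr
  have her : e ∣ r := Finset.dvd_sum fun x hx => hQe x (hRQ hx)
  obtain ⟨M, hMc, hMV, hMs⟩ := exists_multiset_residue (S := V) (k := 20 * κ) (t := m - f - r) hd0
    (by
      have : 0 < (insert 0 (V.image (Nat.cast : ℕ → ZMod d))).card :=
        Finset.card_pos.2 ⟨0, Finset.mem_insert_self _ _⟩
      nlinarith) (Nat.dvd_sub hdvd her)
  rw [ZMod.natCast_eq_natCast_iff] at hMs
  obtain ⟨W, hWP, -, hWc, hW⟩ := exists_subset_sum_modEq M (fun x hx => hP x (hMV x hx)) ∅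
    (by rw [Finset.card_empty]; omega)
  set w := ∑ x ∈ W, x with hw
  have hwn : w ≤ 42 * κ * n := by
    have := Finset.sum_le_card_nsmul W (fun x => x) n fun x hx => (hnA x (hPA (hWP hx))).2
    rw [smul_eq_mul] at this
    refine this.trans (Nat.mul_le_mul_right _ (by omega))
  have h126 : 126 * κ * n = 84 * κ * n + 42 * κ * n := by ring
  have h127 : 126 * κ * n + n ≤ 127 * κ * n := by nlinarith
  have hle : w ≤ m - f - r := by omega
  have hdt : d ∣ m - f - r - w := (Nat.modEq_iff_dvd' hle).1 (hW.trans hMs)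
  -- B may overlap E and P, which contain F and W, so X has to avoid both; R avoids B by
  -- construction.
  obtain ⟨X, hXB, hXU, hXs⟩ := hrep (m - f - r - w) hdt (by omega) (by omega) (E ∪ P) (by
    have := Finset.card_union_le E P
    omega)
  rw [Finset.disjoint_union_right] at hXU
  have hRU : Disjoint R (E ∪ B ∪ P) := Finset.disjoint_of_subset_left hRQ Finset.sdiff_disjoint
  rw [Finset.disjoint_union_right, Finset.disjoint_union_right] at hRU
  have hEP : Disjoint E P := by
    rw [Finset.disjoint_left]
    intro x hx hxP
    exact (Finset.mem_filter.1 hx).2 (heV x (hPV hxP))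
  have hd1 : Disjoint F R := (Finset.disjoint_of_subset_right hF hRU.1.1).symm
  have hd2 : Disjoint (F ∪ R) W := by
    rw [Finset.disjoint_union_left]
    exact ⟨Finset.disjoint_of_subset_left hF (Finset.disjoint_of_subset_right hWP hEP),
      Finset.disjoint_of_subset_right hWP hRU.2⟩
  have hd3 : Disjoint (F ∪ R ∪ W) X := by
    rw [Finset.disjoint_union_left, Finset.disjoint_union_left]
    exact ⟨⟨(Finset.disjoint_of_subset_right hF hXU.1).symm,
      Finset.disjoint_of_subset_right hXB hRU.1.2⟩,
      (Finset.disjoint_of_subset_right hWP hXU.2).symm⟩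
  rw [mem_subsetSums]
  refine ⟨F ∪ R ∪ W ∪ X, ?_, ?_⟩
  · refine Finset.union_subset (Finset.union_subset (Finset.union_subset ?_ (hRQ.trans hQA))
      (hWP.trans hPA)) (hXB.trans hBA)
    exact hF.trans (Finset.filter_subset _ _)
  · rw [Finset.sum_union hd3, Finset.sum_union hd2, Finset.sum_union hd1, hXs]
    omega

end SubsetSumStructure

/-! ### Subset sums modulo snd(m). -/

section Residues

/-- The residues modulo `s` of the subset sums of `E`. -/
def residueSums (s : ℕ) (E : Finset ℕ) : Finset (ZMod s) :=
  (subsetSums E).image Nat.cast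

theorem mem_residueSums {s : ℕ} {E : Finset ℕ} {z : ZMod s} :
    z ∈ residueSums s E ↔ ∃ F ⊆ E, ((∑ x ∈ F, x : ℕ) : ZMod s) = z := by
  simp [residueSums, subsetSums]

theorem residueSums_mono {s : ℕ} {E E' : Finset ℕ} (h : E ⊆ E') :
    residueSums s E ⊆ residueSums s E' := by
  intro z hz
  obtain ⟨F, hF, rfl⟩ := mem_residueSums.1 hz
  exact mem_residueSums.2 ⟨F, hF.trans h, rfl⟩

theorem add_mem_residueSums_insert {s b : ℕ} {E : Finset ℕ} (hb : b ∉ E) {z : ZMod s}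
    (hz : z ∈ residueSums s E) : z + b ∈ residueSums s (insert b E) := by
  obtain ⟨F, hF, rfl⟩ := mem_residueSums.1 hz
  refine mem_residueSums.2 ⟨insert b F, Finset.insert_subset_insert _ hF, ?_⟩
  rw [Finset.sum_insert fun h => hb (hF h)]
  push_cast
  ring

/-- If a new element b adds no residue, the set of residues is stable under adding b, so it contains
all multiples of gcd(s, b). This gcd is less than s, hence divides m. -/
theorem card_lt_card_residueSums_or_mem {s m : ℕ} (hs : 0 < s)
    (hdiv : ∀ e, 0 < e → e < s → e ∣ m) {E : Finset ℕ} (hE : ∀ x ∈ E, ¬ s ∣ x) :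
    E.card < (residueSums s E).card ∨ (m : ZMod s) ∈ residueSums s E := by
  induction E using Finset.induction_on with
  | empty =>
    left
    rw [Finset.card_empty, Finset.card_pos]
    exact ⟨0, mem_residueSums.2 ⟨∅, by simp⟩⟩
  | insert b E hb ih =>
    have hsub := residueSums_mono (s := s) (Finset.subset_insert b E)
    rcases ih fun x hx => hE x (Finset.mem_insert_of_mem hx) with ih | ih
    swap
    · exact Or.inr (hsub ih)
    by_cases hst : residueSums s (insert b E) ⊆ residueSums s E
    · right
      have hmul : ∀ c : ℕ, ((c * b : ℕ) : ZMod s) ∈ residueSums s E := by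
        intro c
        induction c with
        | zero => exact mem_residueSums.2 ⟨∅, by simp⟩
        | succ c ih =>
          have := hst (add_mem_residueSums_insert hb ih)
          rwa [← Nat.cast_add, ← Nat.succ_mul] at this
      have hg0 : 0 < Nat.gcd s b := Nat.gcd_pos_of_pos_left _ hs
      have hgs : Nat.gcd s b < s := by
        refine lt_of_le_of_ne (Nat.le_of_dvd hs (Nat.gcd_dvd_left _ _)) fun h => ?_
        exact hE b (Finset.mem_insert_self _ _) (h ▸ Nat.gcd_dvd_right s b)
      obtain ⟨M, -, hM, hMs⟩ := exists_multiset_residue (S := {b}) (k := 5 * s) (t := m) hs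
        (by
          have : 0 < (insert 0 (({b} : Finset ℕ).image (Nat.cast : ℕ → ZMod s))).card :=
            Finset.card_pos.2 ⟨0, Finset.mem_insert_self _ _⟩
          nlinarith) (by simpa using hdiv _ hg0 hgs)
      have hrep : M = Multiset.replicate M.card b :=
        Multiset.eq_replicate_card.2 fun x hx => Finset.mem_singleton.1 (hM x hx)
      rw [hrep, Multiset.sum_replicate, smul_eq_mul] at hMs
      exact hsub (hMs ▸ hmul _)
    · left
      have := Finset.card_lt_card ⟨hsub, hst⟩
      rw [Finset.card_insert_of_notMem hb]
      omega

theorem exists_subset_sum_modEq_of_le_card {s m : ℕ} (hs : 0 < s)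
    (hdiv : ∀ e, 0 < e → e < s → e ∣ m) {E : Finset ℕ} (hE : ∀ x ∈ E, ¬ s ∣ x)
    (hc : s - 1 ≤ E.card) : ∃ F ⊆ E, F.card ≤ s - 1 ∧ ∑ x ∈ F, x ≡ m [MOD s] := by
  have : NeZero s := ⟨hs.ne'⟩
  obtain ⟨E', hE', hc'⟩ := Finset.exists_subset_card_eq hc
  have hm : (m : ZMod s) ∈ residueSums s E' := by
    rcases card_lt_card_residueSums_or_mem hs hdiv fun x hx => hE x (hE' hx) with h | h
    · have : residueSums s E' = Finset.univ := by
        rw [← Finset.card_eq_iff_eq_univ, ZMod.card]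
        have := Finset.card_le_univ (residueSums s E')
        rw [ZMod.card] at this
        omega
      rw [this]
      exact Finset.mem_univ _
    · exact h
  obtain ⟨F, hF, hFm⟩ := mem_residueSums.1 hm
  refine ⟨F, hF.trans hE', ?_, (ZMod.natCast_eq_natCast_iff _ _ _).1 hFm⟩
  exact hc' ▸ Finset.card_le_card hF

end Residues

/-! ### Constructions of large avoiding sets. -/

section LowerBounds

theorem card_le_maxAvoiding {n m : ℕ} {A : Finset ℕ} (hA : A ⊆ Finset.Icc 1 n)
    (hm : m ∉ subsetSums A) : A.card ≤ maxAvoiding n m :=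
  Finset.le_sup (f := Finset.card) (Finset.mem_filter.2 ⟨Finset.mem_powerset.2 hA, hm⟩)

theorem exists_card_eq_maxAvoiding {n m : ℕ} (hm : 0 < m) :
    ∃ A ⊆ Finset.Icc 1 n, m ∉ subsetSums A ∧ A.card = maxAvoiding n m := by
  have hne : ((Finset.Icc 1 n).powerset.filter fun A => m ∉ subsetSums A).Nonempty := by
    refine ⟨∅, Finset.mem_filter.2 ⟨Finset.empty_mem_powerset _, ?_⟩⟩
    rw [mem_subsetSums]
    rintro ⟨B, hB, h⟩
    rw [Finset.subset_empty.1 hB, Finset.sum_empty] at h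
    omega
  obtain ⟨A, hA, h⟩ := Finset.exists_mem_eq_sup _ hne Finset.card
  rw [Finset.mem_filter, Finset.mem_powerset] at hA
  exact ⟨A, hA.1, hA.2, h.symm⟩

theorem le_maxAvoiding_of_sum_lt {n m k : ℕ} (hk : k ≤ n) (hkm : k * (k + 1) < 2 * m) :
    k ≤ maxAvoiding n m := by
  have hA : Finset.Icc 1 k ⊆ Finset.Icc 1 n := Finset.Icc_subset_Icc_right hk
  have := card_le_maxAvoiding (m := m) hA (by
    rw [mem_subsetSums]
    rintro ⟨B, hB, rfl⟩
    have h1 : ∑ b ∈ B, b ≤ ∑ b ∈ Finset.range (k + 1), b := by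
      apply Finset.sum_le_sum_of_subset
      intro x hx
      have := Finset.mem_Icc.1 (hB hx)
      rw [Finset.mem_range]
      omega
    have h2 := Finset.sum_range_id_mul_two (k + 1)
    simp only [Nat.add_sub_cancel] at h2
    nlinarith)
  simpa using this

/-- With r = m mod s, take all multiples of s, r-1 elements that are 1 mod s, and s-1-r that are -1
mod s. Subset sums are congruent to integers from -(s-1-r) to r-1, and r is congruent to none of
these. The condition s² ≤ n makes room for the extra elements. -/
theorem sBound_le_maxAvoiding {n m : ℕ} (hm : 0 < m) (hn : smallestNonDivisor m ^ 2 ≤ n) :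
    sBound n m ≤ maxAvoiding n m := by
  have hs2 := two_le_smallestNonDivisor hm
  have hsm := (smallestNonDivisor_isLeast hm).1.2
  unfold sBound
  set s := smallestNonDivisor m with hs
  have hs0 : 0 < s := by omega
  set r := m % s with hr
  have hr0 : 0 < r := Nat.pos_of_ne_zero fun h => hsm (Nat.dvd_of_mod_eq_zero h)
  have hrs : r < s := Nat.mod_lt _ hs0
  set Z := (Finset.Icc 1 (n / s)).image (fun j => j * s) with hZ
  set P := (Finset.range (r - 1)).image (fun j => j * s + 1) with hP
  set N := (Finset.range (s - 1 - r)).image (fun j => j * s + (s - 1)) with hN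
  have hZm : ∀ x ∈ Z, x % s = 0 := by
    intro x hx
    obtain ⟨j, -, rfl⟩ := Finset.mem_image.1 hx
    exact Nat.mul_mod_left j s
  have hPm : ∀ x ∈ P, x % s = 1 := by
    intro x hx
    obtain ⟨j, -, rfl⟩ := Finset.mem_image.1 hx
    rw [mul_comm, Nat.mul_add_mod]
    exact Nat.mod_eq_of_lt (by omega)
  have hNm : ∀ x ∈ N, x % s = s - 1 ∧ s ≠ 2 := by
    intro x hx
    obtain ⟨j, hj, rfl⟩ := Finset.mem_image.1 hx
    rw [Finset.mem_range] at hj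
    rw [mul_comm, Nat.mul_add_mod]
    exact ⟨Nat.mod_eq_of_lt (by omega), by omega⟩
  have hd1 : Disjoint Z P := Finset.disjoint_left.2 fun x hx hx' => by
    have := hZm x hx
    have := hPm x hx'
    omega
  have hd2 : Disjoint (Z ∪ P) N := Finset.disjoint_left.2 fun x hx hx' => by
    have h3 := hNm x hx'
    rcases Finset.mem_union.1 hx with hx | hx
    · have := hZm x hx
      omega
    · have := hPm x hx
      omega
  have hZc : Z.card = n / s := by
    rw [hZ, Finset.card_image_of_injective _ (fun a b h => Nat.eq_of_mul_eq_mul_right hs0 h)]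
    simp
  have hPc : P.card = r - 1 := by
    rw [hP, Finset.card_image_of_injective _
      (fun a b h => Nat.eq_of_mul_eq_mul_right hs0 (Nat.add_right_cancel h)), Finset.card_range]
  have hNc : N.card = s - 1 - r := by
    rw [hN, Finset.card_image_of_injective _
      (fun a b h => Nat.eq_of_mul_eq_mul_right hs0 (Nat.add_right_cancel h)), Finset.card_range]
  have hcard : (Z ∪ P ∪ N).card = n / s + s - 2 := by
    rw [Finset.card_union_of_disjoint hd2, Finset.card_union_of_disjoint hd1, hZc, hPc, hNc]
    omega
  rw [← hcard]
  apply card_le_maxAvoiding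
  · intro x hx
    rw [Finset.mem_Icc]
    rw [Finset.mem_union, Finset.mem_union] at hx
    rcases hx with (hx | hx) | hx <;> obtain ⟨j, hj, rfl⟩ := Finset.mem_image.1 hx
    · rw [Finset.mem_Icc] at hj
      exact ⟨Nat.mul_pos hj.1 hs0, (Nat.mul_le_mul_right s hj.2).trans (Nat.div_mul_le_self n s)⟩
    · rw [Finset.mem_range] at hj
      refine ⟨by omega, le_trans ?_ hn⟩
      have : (j + 1) * s ≤ s * s := Nat.mul_le_mul_right _ (by omega)
      nlinarith
    · rw [Finset.mem_range] at hj
      refine ⟨by omega, le_trans ?_ hn⟩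
      have : (j + 1) * s ≤ s * s := Nat.mul_le_mul_right _ (by omega)
      rw [pow_two]
      rw [Nat.succ_mul] at this
      omega
  · rw [mem_subsetSums]
    rintro ⟨B, hB, hBm⟩
    -- The signed residue 0, 1 or -1 of an element of the construction.
    set φ : ℕ → ℤ := fun x => (if x ∈ P then 1 else 0) - (if x ∈ N then 1 else 0) with hφ
    have hφs : ∀ x ∈ B, (s : ℤ) ∣ (x : ℤ) - φ x := by
      intro x hx
      have hx := hB hx
      have hdm : (x : ℤ) = (s : ℤ) * (x / s : ℕ) + (x % s : ℕ) := by
        exact_mod_cast (Nat.div_add_mod x s).symm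
      by_cases hxN : x ∈ N
      · have hxP : x ∉ P := fun h =>
          Finset.disjoint_left.1 hd2 (Finset.mem_union_right _ h) hxN
        refine ⟨(x / s : ℕ) + 1, ?_⟩
        rw [(hNm x hxN).1, Nat.cast_sub (by omega)] at hdm
        simp only [hφ, hxN, hxP, if_true, if_false]
        rw [hdm]
        push_cast
        ring
      · rw [Finset.mem_union, or_iff_left hxN, Finset.mem_union] at hx
        refine ⟨(x / s : ℕ), ?_⟩
        rcases hx with hx | hx
        · have hxP : x ∉ P := Finset.disjoint_left.1 hd1 hx
          rw [hZm x hx] at hdm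
          simp only [hφ, hxN, hxP, if_false]
          rw [hdm]
          push_cast
          ring
        · rw [hPm x hx] at hdm
          simp only [hφ, hxN, hx, if_true, if_false]
          rw [hdm]
          push_cast
          ring
    have hsum : (s : ℤ) ∣ (m : ℤ) - ∑ x ∈ B, φ x := by
      rw [← hBm]
      push_cast
      rw [← Finset.sum_sub_distrib]
      exact Finset.dvd_sum hφs
    have hle : ∀ Y : Finset ℕ, 0 ≤ ∑ x ∈ B, (if x ∈ Y then (1 : ℤ) else 0) ∧
        ∑ x ∈ B, (if x ∈ Y then (1 : ℤ) else 0) ≤ Y.card := by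
      intro Y
      rw [← Finset.sum_filter, Finset.sum_const, nsmul_one]
      refine ⟨by positivity, ?_⟩
      have : B.filter (· ∈ Y) ⊆ Y := fun x hx => (Finset.mem_filter.1 hx).2
      exact_mod_cast Finset.card_le_card this
    have hP' := hle P
    have hN' := hle N
    have hsplit : ∑ x ∈ B, φ x = ∑ x ∈ B, (if x ∈ P then (1 : ℤ) else 0) -
        ∑ x ∈ B, (if x ∈ N then (1 : ℤ) else 0) := Finset.sum_sub_distrib _ _
    rw [hPc] at hP'
    rw [hNc] at hN'
    have hmr : (s : ℤ) ∣ (r : ℤ) - ∑ x ∈ B, φ x := by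
      have h1 : (m : ℤ) = (s : ℤ) * (m / s : ℕ) + (r : ℕ) := by
        exact_mod_cast (Nat.div_add_mod m s).symm
      have h2 : (r : ℤ) - ∑ x ∈ B, φ x = (m : ℤ) - ∑ x ∈ B, φ x - s * (m / s : ℕ) := by
        rw [h1]
        ring
      rw [h2]
      exact dvd_sub hsum (dvd_mul_right _ _)
    have := Int.le_of_dvd (by omega) hmr
    omega

end LowerBounds

/-! ### A Chebyshev bound and the size of snd(m). -/

section ChebyshevBound

/-- The terms with d > X vanish; the longer range lets several factorials share one sum. -/
theorem log_factorial_eq_sum_vonMangoldt {X Y : ℕ} (h : X ≤ Y) :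
    Real.log (X.factorial : ℝ) =
      ∑ d ∈ Finset.Ioc 0 Y, ArithmeticFunction.vonMangoldt d * ((X / d : ℕ) : ℝ) := by
  have h1 := ArithmeticFunction.sum_Ioc_mul_zeta_eq_sum ArithmeticFunction.vonMangoldt X
  rw [ArithmeticFunction.vonMangoldt_mul_zeta] at h1
  have h2 : Real.log (X.factorial : ℝ) = ∑ n ∈ Finset.Ioc 0 X, ArithmeticFunction.log n := by
    induction X with
    | zero => simp
    | succ k ih =>
      rw [Finset.sum_Ioc_succ_top (Nat.zero_le k), ← ih (by omega)
        (by rw [← ArithmeticFunction.vonMangoldt_mul_zeta,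
          ArithmeticFunction.sum_Ioc_mul_zeta_eq_sum]), Nat.factorial_succ]
      push_cast
      rw [Real.log_mul (by positivity) (by positivity), ArithmeticFunction.log_apply]
      push_cast
      ring
  rw [h2, h1]
  apply Finset.sum_subset (Finset.Ioc_subset_Ioc_right h)
  intro d hd hd'
  rw [Finset.mem_Ioc] at hd hd'
  rw [Nat.div_eq_of_lt (by omega)]
  simp

theorem log_factorial_le (k : ℕ) (hk : 1 ≤ k) :
    Real.log (k.factorial : ℝ) ≤ k * Real.log k - k + Real.log k + 1 := by
  induction k, hk using Nat.le_induction with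
  | base => simp
  | succ k hk ih =>
    have hk0 : (0 : ℝ) < k := by exact_mod_cast hk
    rw [Nat.factorial_succ]
    push_cast
    rw [Real.log_mul (by positivity) (by positivity)]
    have h1 := Real.one_sub_inv_le_log_of_pos (x := ((k : ℝ) + 1) / k) (by positivity)
    rw [Real.log_div (by positivity) (by positivity)] at h1
    have h2 : ((k : ℝ) + 1) * (1 - (((k : ℝ) + 1) / k)⁻¹) = 1 := by
      field_simp
      ring
    nlinarith

/-- With q = ⌊12N/d⌋, the coefficient of Λ(d) is q + ⌊q/12⌋ - ⌊q/2⌋ - ⌊q/3⌋ - ⌊q/4⌋ ≤ 1. -/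
theorem log_factorial_combination_le_psi (N : ℕ) :
    Real.log ((12 * N).factorial : ℝ) + Real.log (N.factorial : ℝ) -
      Real.log ((6 * N).factorial : ℝ) - Real.log ((4 * N).factorial : ℝ) -
      Real.log ((3 * N).factorial : ℝ) ≤ Chebyshev.psi ((12 * N : ℕ) : ℝ) := by
  rw [log_factorial_eq_sum_vonMangoldt (le_refl (12 * N)),
    log_factorial_eq_sum_vonMangoldt (show N ≤ 12 * N by omega),
    log_factorial_eq_sum_vonMangoldt (show 6 * N ≤ 12 * N by omega),
    log_factorial_eq_sum_vonMangoldt (show 4 * N ≤ 12 * N by omega),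
    log_factorial_eq_sum_vonMangoldt (show 3 * N ≤ 12 * N by omega),
    ← Finset.sum_add_distrib, ← Finset.sum_sub_distrib, ← Finset.sum_sub_distrib,
    ← Finset.sum_sub_distrib, Chebyshev.psi, Nat.floor_natCast]
  apply Finset.sum_le_sum
  intro d _
  have hq : ∀ c e : ℕ, 0 < c → c * e = 12 * N → e / d = 12 * N / d / c := by
    intro c e hc h
    rw [Nat.div_div_eq_div_mul, mul_comm d c, ← Nat.div_div_eq_div_mul, ← h,
      Nat.mul_div_cancel_left _ hc]
  have hle : (12 * N / d : ℕ) + N / d ≤ 1 + 6 * N / d + 4 * N / d + 3 * N / d := by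
    rw [hq 12 N (by norm_num) (by ring), hq 2 (6 * N) (by norm_num) (by ring),
      hq 3 (4 * N) (by norm_num) (by ring), hq 4 (3 * N) (by norm_num) (by ring)]
    omega
  have hle' : ((12 * N / d : ℕ) : ℝ) + (N / d : ℕ) ≤
      1 + (6 * N / d : ℕ) + (4 * N / d : ℕ) + (3 * N / d : ℕ) := by exact_mod_cast hle
  have h0 := ArithmeticFunction.vonMangoldt_nonneg (n := d)
  nlinarith

/-- A lower bound of Chebyshev type, with a constant larger than `log 2`. -/
theorem exists_le_psi_mul_twelve :
    ∃ C : ℝ, ∀ N : ℕ, 10.1 * (N : ℝ) - C ≤ Chebyshev.psi ((12 * N : ℕ) : ℝ) := by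
  refine ⟨Real.log 6 + Real.log 4 + Real.log 3 + 3 * Real.log 30, fun N => ?_⟩
  have hl6 := Real.log_nonneg (show (1 : ℝ) ≤ 6 by norm_num)
  have hl4 := Real.log_nonneg (show (1 : ℝ) ≤ 4 by norm_num)
  have hl3 := Real.log_nonneg (show (1 : ℝ) ≤ 3 by norm_num)
  have hl30 := Real.log_nonneg (show (1 : ℝ) ≤ 30 by norm_num)
  rcases Nat.eq_zero_or_pos N with rfl | hN
  · have := Chebyshev.psi_nonneg ((12 * 0 : ℕ) : ℝ)
    push_cast at this ⊢
    linarith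
  refine le_trans ?_ (log_factorial_combination_le_psi N)
  have hN0 : (0 : ℝ) < N := by exact_mod_cast hN
  have hlow : ∀ k : ℕ, 1 ≤ k → (k : ℝ) * Real.log k - k ≤ Real.log (k.factorial : ℝ) := by
    intro k hk
    have h1 := Stirling.le_log_factorial_stirling (n := k) (by omega)
    have h2 : 0 ≤ Real.log (k : ℝ) := Real.log_natCast_nonneg k
    have h3 : 0 ≤ Real.log (2 * Real.pi) := Real.log_nonneg (by linarith [Real.pi_gt_three])
    linarith
  have e1 := hlow (12 * N) (by omega)
  have e2 := hlow N hN
  have e3 := log_factorial_le (6 * N) (by omega)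
  have e4 := log_factorial_le (4 * N) (by omega)
  have e5 := log_factorial_le (3 * N) (by omega)
  push_cast at e1 e3 e4 e5
  have l12 : Real.log 12 = 2 * Real.log 2 + Real.log 3 := by
    rw [show (12 : ℝ) = 2 ^ 2 * 3 by norm_num, Real.log_mul (by norm_num) (by norm_num),
      Real.log_pow]
    norm_num
  have l6 : Real.log 6 = Real.log 2 + Real.log 3 := by
    rw [show (6 : ℝ) = 2 * 3 by norm_num, Real.log_mul (by norm_num) (by norm_num)]
  have l4 : Real.log 4 = 2 * Real.log 2 := by
    rw [show (4 : ℝ) = 2 ^ 2 by norm_num, Real.log_pow]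
    norm_num
  have l3 : 19 * Real.log 2 ≤ 12 * Real.log 3 := by
    have := Real.log_le_log (by norm_num) (show (2 : ℝ) ^ 19 ≤ 3 ^ 12 by norm_num)
    rw [Real.log_pow, Real.log_pow] at this
    exact_mod_cast this
  have l2 := Real.log_two_gt_d9
  rw [Real.log_mul (by norm_num) hN0.ne'] at e1 e3 e4 e5
  -- The three upper bounds leave 3 log N, which costs N/10: the drop from 10.2 to 10.1. The main
  -- terms in N log N and N cancel except for N(10 log 2 + 3 log 3).
  have hlogN : Real.log N ≤ N / 30 + Real.log 30 - 1 := by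
    have := Real.log_le_sub_one_of_pos (show (0 : ℝ) < N / 30 by positivity)
    rw [Real.log_div hN0.ne' (by norm_num)] at this
    linarith
  have hmain : 10.2 * (N : ℝ) ≤ N * (10 * Real.log 2 + 3 * Real.log 3) := by
    rw [mul_comm]
    apply mul_le_mul_of_nonneg_left _ hN0.le
    linarith
  rw [l12] at e1
  rw [l6] at e3 ⊢
  rw [l4] at e4 ⊢
  linarith

theorem psi_le_log_of_forall_dvd {k m : ℕ} (hm : 0 < m) (h : ∀ e, 0 < e → e ≤ k → e ∣ m) :
    Chebyshev.psi (k : ℝ) ≤ Real.log m := by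
  rw [Chebyshev.psi_eq_log_lcmUpto]
  apply Real.log_le_log
  · exact_mod_cast Nat.lcmUpto_pos k
  · have : Nat.lcmUpto k ∣ m := Finset.lcm_dvd fun e he => by
      rw [Finset.mem_Icc] at he
      exact h e he.1 he.2
    exact_mod_cast Nat.le_of_dvd hm this

theorem dvd_of_lt_smallestNonDivisor {m e : ℕ} (he : 0 < e) (h : e < smallestNonDivisor m) :
    e ∣ m := by
  by_contra hd
  exact absurd (Nat.sInf_le (show e ∈ {d : ℕ | 0 < d ∧ ¬ d ∣ m} from ⟨he, hd⟩)) (not_le.2 h)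

theorem exists_smallestNonDivisor_le_log :
    ∃ C : ℝ, ∀ m : ℕ, 0 < m → 0.84 * (smallestNonDivisor m : ℝ) ≤ Real.log m + C := by
  obtain ⟨C, hC⟩ := exists_le_psi_mul_twelve
  refine ⟨C + 10.1, fun m hm => ?_⟩
  set s := smallestNonDivisor m with hs
  have h2 := two_le_smallestNonDivisor hm
  have h1 := hC ((s - 1) / 12)
  have h3 : Chebyshev.psi ((12 * ((s - 1) / 12) : ℕ) : ℝ) ≤ Real.log m :=
    psi_le_log_of_forall_dvd hm fun e he hek => dvd_of_lt_smallestNonDivisor he (by omega)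
  have h4 : s ≤ 12 * ((s - 1) / 12) + 12 := by omega
  have h5 : (s : ℝ) ≤ 12 * (((s - 1) / 12 : ℕ) : ℝ) + 12 := by exact_mod_cast h4
  linarith

end ChebyshevBound

/-! ### Upper bounds and the two ranges of m. -/

section Main

open Filter

theorem mem_subsetSums_of_sBound_lt {n κ m q : ℕ} (hn1 : 0 < n) (hm : 0 < m) {A B : Finset ℕ}
    (hBA : B ⊆ A) (hA : A ⊆ Finset.Icc 1 n) (hκ : n ≤ κ * B.card) (hn : 20000 * κ ^ 4 ≤ n)
    (hs : sBound n m < A.card) (hq : q + B.card + 336 * κ ^ 2 ≤ A.card) (hqm : 2 * m ≤ q ^ 2)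
    (hlow : smallestNonDivisor m * n + 126 * κ * n ≤ m)
    (hgap : 168 * κ ^ 2 + n / (smallestNonDivisor m + 1) <
      n / smallestNonDivisor m + smallestNonDivisor m - 1) :
    m ∈ subsetSums A := by
  obtain ⟨e, he0, hE, hmain⟩ := exists_divisor_mem_subsetSums hn1 hBA hA hκ hn
  by_cases hem : e ∣ m
  · refine hmain ∅ (by simp) q m hq hqm ?_ (by simpa using hem)
    rw [Finset.sum_empty, zero_add]
    omega
  have hse : smallestNonDivisor m ≤ e := (smallestNonDivisor_isLeast hm).2 ⟨he0, hem⟩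
  have hs2 := two_le_smallestNonDivisor hm
  unfold sBound at hs
  have hAe : (A.filter fun x => e ∣ x).card ≤ n / e := by
    rw [← Nat.Ioc_filter_dvd_card_eq_div]
    apply Finset.card_le_card
    intro x hx
    rw [Finset.mem_filter] at hx ⊢
    have := Finset.mem_Icc.1 (hA hx.1)
    exact ⟨Finset.mem_Ioc.2 ⟨by omega, this.2⟩, hx.2⟩
  have hsplit := Finset.card_filter_add_card_filter_not (s := A) fun x => e ∣ x
  rcases hse.eq_or_lt with rfl | hlt
  -- At most ⌊n/s⌋ elements of A are multiples of s, so |A| > s(n,m) leaves at least s-1 others.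
  · obtain ⟨F, hF, hFc, hFm⟩ := exists_subset_sum_modEq_of_le_card (m := m) he0
      (fun e he h => dvd_of_lt_smallestNonDivisor he h)
      (E := A.filter fun x => ¬ smallestNonDivisor m ∣ x)
      (fun x hx => (Finset.mem_filter.1 hx).2) (by omega)
    have hFn : ∑ x ∈ F, x ≤ smallestNonDivisor m * n := by
      have := Finset.sum_le_card_nsmul F (fun x => x) n fun x hx =>
        (Finset.mem_Icc.1 (hA (Finset.mem_filter.1 (hF hx)).1)).2
      rw [smul_eq_mul] at this
      exact this.trans (Nat.mul_le_mul_right _ (by omega))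
    exact hmain F hF q m hq hqm (by omega) ((Nat.modEq_iff_dvd' (by omega)).1 hFm)
  · have : n / e ≤ n / (smallestNonDivisor m + 1) := Nat.div_le_div_left hlt (by omega)
    omega

theorem le_card_mul_of_sBound_lt {n m c : ℕ} (hm : 0 < m) (h : sBound n m < c) :
    n ≤ c * smallestNonDivisor m := by
  have hs2 := two_le_smallestNonDivisor hm
  unfold sBound at h
  have h1 : n / smallestNonDivisor m + 1 ≤ c := by omega
  have h2 := Nat.lt_div_mul_add (a := n) (b := smallestNonDivisor m) (by omega)
  nlinarith

theorem exists_forall_log_pow_le (D : ℝ) :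
    ∃ N : ℕ, 3 ≤ N ∧ ∀ n : ℕ, N ≤ n →
      1 ≤ Real.log n ∧ D ≤ Real.log n ∧ D * Real.log n ^ 4 ≤ n := by
  have h1 : Tendsto (fun n : ℕ => Real.log (n : ℝ)) atTop atTop :=
    Real.tendsto_log_atTop.comp tendsto_natCast_atTop_atTop
  have h2 := ((Real.isLittleO_pow_log_id_atTop (n := 4)).comp_tendsto
    (tendsto_natCast_atTop_atTop (R := ℝ))).bound (show (0 : ℝ) < 1 / (|D| + 1) by positivity)
  obtain ⟨N, hN⟩ := eventually_atTop.1
    (((h1.eventually_ge_atTop 1).and (h1.eventually_ge_atTop D)).and h2)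
  refine ⟨max N 3, le_max_right _ _, fun n hn => ?_⟩
  obtain ⟨⟨ha, hb⟩, hc⟩ := hN n ((le_max_left _ _).trans hn)
  refine ⟨ha, hb, ?_⟩
  simp only [Function.comp_apply, id, Real.norm_eq_abs, Nat.abs_cast] at hc
  have h4 : (0 : ℝ) ≤ Real.log n ^ 4 := by positivity
  rw [abs_of_nonneg h4, div_mul_eq_mul_div, one_mul, le_div_iff₀ (by positivity)] at hc
  nlinarith [le_abs_self D]

theorem add_div_succ_lt_div_add {n s c : ℕ} (hs : 2 ≤ s) (h : c * (s * (s + 1)) ≤ n) :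
    c + n / (s + 1) < n / s + s - 1 := by
  have h1 : c + n / (s + 1) ≤ n / s := by
    rw [Nat.le_div_iff_mul_le (by omega)]
    have h2 := Nat.div_mul_le_self n (s + 1)
    have h3 : c * s ≤ n / (s + 1) := by
      rw [Nat.le_div_iff_mul_le (by omega)]
      linarith
    nlinarith
  omega

/-- A share ηa/4 of A has density at least η/(12L); raising 12 to 13 in κ pays for rounding the
share to an integer, and 14 pays for rounding κ. The first bound says that the 336κ² lost elements
also cost at most ηa/4. -/
theorem dense_set_bounds {η L n a : ℝ} (hη : 0 < η) (hη1 : η ≤ 1) (hL : 1 ≤ L)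
    (hn : 20000 * (14 / η * L) ^ 4 ≤ n) (ha : n ≤ a * (3 * L)) :
    1344 * (14 / η * L) ^ 2 ≤ η * a ∧
      ∀ b κ : ℝ, 13 * L / η ≤ κ → η * a / 4 < b + 1 → n ≤ κ * b := by
  obtain ⟨v, hv⟩ : ∃ v, v = 14 / η * L := ⟨_, rfl⟩
  have hv14 : 14 ≤ v := by
    have : 14 ≤ 14 / η := by
      rw [le_div_iff₀ hη]
      linarith
    rw [hv]
    nlinarith
  rw [← hv] at hn ⊢
  have hva : n * 14 ≤ η * a * (3 * v) := by
    have : η * a * (3 * v) = 14 * (a * (3 * L)) := by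
      rw [hv]; field_simp
    rw [this]
    linarith
  have hp2 : 14 ^ 2 ≤ v ^ 2 := by gcongr
  have hp3 : 14 ^ 3 ≤ v ^ 3 := by gcongr
  have hv4 : v ^ 3 * 14 ≤ v ^ 4 := by
    rw [pow_succ v 3]
    gcongr
  have hv3 : 1344 * v ^ 2 * (3 * v) = 4032 * v ^ 3 := by ring
  have h1344 : 1344 * v ^ 2 ≤ η * a :=
    le_of_mul_le_mul_right (a := 3 * v) (by linarith) (by linarith)
  refine ⟨h1344, fun b κ hκ hb => ?_⟩
  have h0 : 0 ≤ η * a / 4 - 1 := by linarith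
  have h1 : 13 * L / η * (η * a / 4 - 1) ≤ κ * b :=
    mul_le_mul hκ (by linarith) h0 (le_trans (by positivity) hκ)
  have h2 : 13 * L / η * (η * a / 4 - 1) = 13 / 12 * (a * (3 * L)) - 13 / 14 * v := by
    rw [hv]
    field_simp
    ring
  have h3 : v * 14 ^ 3 ≤ v ^ 4 := by
    rw [pow_succ' v 3]
    gcongr
  linarith

/-- A set larger than `s(n, m)` and than `(1 + η) √(2m)` has `m` as a subset sum. -/
theorem exists_forall_mem_subsetSums {η : ℝ} (hη : 0 < η) (hη1 : η ≤ 1) :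
    ∃ C : ℝ, 0 < C ∧ ∃ N : ℕ, ∀ n m : ℕ, N ≤ n → 0 < m → C * n * Real.log n ≤ m →
      (smallestNonDivisor m : ℝ) ≤ 3 * Real.log n → ∀ A ⊆ Finset.Icc 1 n,
      sBound n m < A.card → (1 + η) * √(2 * (m : ℝ)) ≤ A.card → m ∈ subsetSums A := by
  obtain ⟨u, hu⟩ : ∃ u, u = 14 / η := ⟨_, rfl⟩
  have hu14 : 14 ≤ u := by
    rw [hu, le_div_iff₀ hη]
    linarith
  obtain ⟨N, -, hN⟩ := exists_forall_log_pow_le (20000 * u ^ 4)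
  refine ⟨3 + 126 * u, by positivity, max N 1, ?_⟩
  intro n m hn hm hmn hsL A hA hsA hmA
  obtain ⟨hL, -, hnL⟩ := hN n ((le_max_left _ _).trans hn)
  have hn1 : 0 < n := (le_max_right _ _).trans hn
  set L := Real.log n with hLdef
  have hL0 : 0 < L := by linarith
  have hu0 : 0 < u := by linarith
  have hs2 := two_le_smallestNonDivisor hm
  have hs2' : (2 : ℝ) ≤ smallestNonDivisor m := by exact_mod_cast hs2
  have hn0 : (0 : ℝ) < n := by exact_mod_cast hn1
  have huL : 14 ≤ u * L := by nlinarith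
  have hnX : 20000 * (u * L) ^ 4 ≤ n := by rwa [mul_pow, ← mul_assoc]
  set κ := ⌈13 * L / η⌉₊ with hκdef
  have hκ1 : 13 * L / η ≤ κ := Nat.le_ceil _
  have hκ2 : (κ : ℝ) ≤ u * L := by
    have h1 : (κ : ℝ) < 13 * L / η + 1 := Nat.ceil_lt_add_one (by positivity)
    have h2 : 13 * L / η + L / η = u * L := by rw [hu]; field_simp; ring
    have h3 : 1 ≤ L / η := by rw [le_div_iff₀ hη]; linarith
    linarith
  have hκ22 : (κ : ℝ) ^ 2 ≤ (u * L) ^ 2 := by gcongr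
  have hκ24 : (κ : ℝ) ^ 4 ≤ (u * L) ^ 4 := by gcongr
  have hA3 : (n : ℝ) ≤ A.card * (3 * L) := by
    have := le_card_mul_of_sBound_lt hm hsA
    have h1 : (n : ℝ) ≤ A.card * smallestNonDivisor m := by exact_mod_cast this
    exact h1.trans (by gcongr)
  obtain ⟨hηA, hbκ⟩ := dense_set_bounds hη hη1 hL (hu ▸ hnX) hA3
  rw [← hu] at hηA
  set b := ⌊η * A.card / 4⌋₊ with hb
  have hb1 : (b : ℝ) ≤ η * A.card / 4 := Nat.floor_le (by positivity)
  have hb2 : η * A.card / 4 < b + 1 := Nat.lt_floor_add_one _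
  have hbA : b ≤ A.card := by
    have hA0 : (0 : ℝ) ≤ A.card := by positivity
    have : η * A.card ≤ A.card := mul_le_of_le_one_left hA0 hη1
    have : (b : ℝ) ≤ A.card := by linarith
    exact_mod_cast this
  obtain ⟨B, hBA, hBc⟩ := Finset.exists_subset_card_eq hbA
  have hκn : n ≤ κ * B.card := by
    rw [hBc]
    exact_mod_cast hbκ b κ hκ1 hb2
  have hκ4 : 20000 * κ ^ 4 ≤ n := by
    have : 20000 * (κ : ℝ) ^ 4 ≤ n := by linarith
    exact_mod_cast this
  have hqle : B.card + 336 * κ ^ 2 ≤ A.card := by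
    rw [hBc]
    have : (b : ℝ) + 336 * (κ : ℝ) ^ 2 ≤ A.card := by
      have : η * A.card ≤ A.card := mul_le_of_le_one_left (Nat.cast_nonneg _) hη1
      linarith
    exact_mod_cast this
  refine mem_subsetSums_of_sBound_lt (q := A.card - (B.card + 336 * κ ^ 2)) hn1 hm hBA hA hκn hκ4
    hsA (by omega) ?_ ?_ ?_
  · have h1 : A.card * (1 - η / 2) ≤ ((A.card - (B.card + 336 * κ ^ 2) : ℕ) : ℝ) := by
      rw [Nat.cast_sub hqle, hBc]
      push_cast
      linarith
    have h2 : √(2 * (m : ℝ)) ≤ ((A.card - (B.card + 336 * κ ^ 2) : ℕ) : ℝ) := by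
      refine le_trans ?_ h1
      have h3 : 0 ≤ √(2 * (m : ℝ)) := Real.sqrt_nonneg _
      have h4 : (1 + η) * √(2 * (m : ℝ)) * (1 - η / 2) ≤ A.card * (1 - η / 2) :=
        mul_le_mul_of_nonneg_right hmA (by linarith)
      -- Here (1 + η)(1 - η/2) = 1 + η(1 - η)/2 ≥ 1.
      have h5 : 0 ≤ √(2 * (m : ℝ)) * (η * (1 - η)) :=
        mul_nonneg h3 (mul_nonneg hη.le (by linarith))
      nlinarith
    have h3 := (Real.sqrt_le_left (by positivity)).1 h2
    exact_mod_cast h3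
  · have : (smallestNonDivisor m : ℝ) * n + 126 * κ * n ≤ m := by
      refine le_trans ?_ hmn
      have h1 : (smallestNonDivisor m : ℝ) * n ≤ 3 * L * n := by gcongr
      have h2 : 126 * (κ : ℝ) * n ≤ 126 * (u * L) * n := by gcongr
      linarith
    exact_mod_cast this
  · set s := smallestNonDivisor m with hs
    have h4 : 168 * (κ : ℝ) ^ 2 * (s * (s + 1)) ≤ n := by
      have hss : (s : ℝ) * (s + 1) ≤ 12 * L ^ 2 := by
        calc (s : ℝ) * (s + 1) ≤ (3 * L) * (3 * L + L) := by gcongr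
          _ = 12 * L ^ 2 := by ring
      have hLu : L ^ 2 ≤ (u * L) ^ 2 := by
        have : L ≤ u * L := le_mul_of_one_le_left hL0.le (by linarith)
        gcongr
      calc 168 * (κ : ℝ) ^ 2 * (s * (s + 1)) ≤ 168 * (u * L) ^ 2 * (12 * (u * L) ^ 2) := by
            apply mul_le_mul (by linarith) (by linarith) (by positivity) (by positivity)
        _ = 2016 * (u * L) ^ 4 := by ring
        _ ≤ (n : ℝ) := by linarith
    exact add_div_succ_lt_div_add hs2 (by exact_mod_cast h4)

theorem exists_smallestNonDivisor_le_log_of_le_sq :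
    ∃ N : ℕ, ∀ n m : ℕ, N ≤ n → 0 < m → (m : ℝ) ≤ (n : ℝ) ^ 2 →
      (smallestNonDivisor m : ℝ) ≤ 2.39 * Real.log n := by
  obtain ⟨C, hC⟩ := exists_smallestNonDivisor_le_log
  obtain ⟨N, -, hN⟩ := exists_forall_log_pow_le (1000 * C)
  refine ⟨N, fun n m hn hm hmn => ?_⟩
  obtain ⟨-, h1, -⟩ := hN n hn
  have h2 := hC m hm
  have h3 := Real.log_le_log (by exact_mod_cast hm) hmn
  rw [Real.log_pow] at h3
  push_cast at h3
  linarith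

theorem exists_forall_sBound_le_maxAvoiding :
    ∃ N : ℕ, ∀ n m : ℕ, N ≤ n → 0 < m → (m : ℝ) ≤ (n : ℝ) ^ 2 →
      sBound n m ≤ maxAvoiding n m := by
  obtain ⟨N₁, hN₁⟩ := exists_smallestNonDivisor_le_log_of_le_sq
  obtain ⟨N₂, -, hN₂⟩ := exists_forall_log_pow_le 9
  refine ⟨max N₁ N₂, fun n m hn hm hmn => sBound_le_maxAvoiding hm ?_⟩
  have h1 := hN₁ n m ((le_max_left _ _).trans hn) hm hmn
  obtain ⟨h2, -, h3⟩ := hN₂ n ((le_max_right _ _).trans hn)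
  have h4 : (smallestNonDivisor m : ℝ) ^ 2 ≤ n := by
    have h5 : Real.log n ^ 2 ≤ Real.log n ^ 4 := pow_le_pow_right₀ h2 (by norm_num)
    have h6 : (smallestNonDivisor m : ℝ) ^ 2 ≤ (2.39 * Real.log n) ^ 2 := by gcongr
    nlinarith
  exact_mod_cast h4

theorem exists_forall_maxAvoiding_eq_sBound :
    ∃ C : ℝ, 0 < C ∧ ∀ n m : ℕ, 2 ≤ n → 0 < m →
      C * (n : ℝ) * Real.log (n : ℝ) ≤ (m : ℝ) →
      (m : ℝ) ≤ (n : ℝ) ^ 2 / (12 * Real.log (n : ℝ) ^ 2) →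
      maxAvoiding n m = sBound n m := by
  obtain ⟨C, hC0, N₁, hN₁⟩ := exists_forall_mem_subsetSums (η := 0.02) (by norm_num) (by norm_num)
  obtain ⟨N₂, hN₂⟩ := exists_smallestNonDivisor_le_log_of_le_sq
  obtain ⟨N₃, hN₃⟩ := exists_forall_sBound_le_maxAvoiding
  set N := max N₁ (max N₂ N₃) with hN
  -- With the constant at least N, the range of m is empty unless n ≥ N, so small n need no separate
  -- treatment.
  refine ⟨max C N, lt_max_of_lt_left hC0, ?_⟩
  intro n m hn hm hlow hup
  have hn2 : (2 : ℝ) ≤ n := by exact_mod_cast hn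
  have hL2 : 0.69 ≤ Real.log n := by
    have := Real.log_le_log (by norm_num) hn2
    linarith [Real.log_two_gt_d9]
  set L := Real.log n with hL
  have hLsq : 0.69 ^ 2 ≤ L ^ 2 := by gcongr
  have hnN : N ≤ n := by
    have h1 : (N : ℝ) * n * L ≤ n ^ 2 / (12 * L ^ 2) := by
      refine le_trans ?_ (hlow.trans hup)
      gcongr
      exact le_max_right _ _
    rw [le_div_iff₀ (by positivity)] at h1
    have h2 : (N : ℝ) ≤ n := by
      have h3 : (N : ℝ) * (12 * L ^ 3) * n ≤ n * n := by nlinarith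
      have h4 := le_of_mul_le_mul_right h3 (by linarith)
      have h5 : (1 : ℝ) ≤ 12 * L ^ 3 := by
        have : (0.69 : ℝ) ^ 3 ≤ L ^ 3 := by gcongr
        norm_num at this ⊢
        linarith
      have h6 : (0 : ℝ) ≤ N := by positivity
      nlinarith
    exact_mod_cast h2
  have hmn : (m : ℝ) ≤ (n : ℝ) ^ 2 := by
    refine hup.trans (div_le_self (by positivity) ?_)
    norm_num at hLsq
    linarith
  have hN1 : N₁ ≤ n := (le_max_left _ _).trans hnN
  have hN2 : N₂ ≤ n := (le_max_left _ _).trans ((le_max_right _ _).trans hnN)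
  have hN3 : N₃ ≤ n := (le_max_right _ _).trans ((le_max_right _ _).trans hnN)
  have hs := hN₂ n m hN2 hm hmn
  refine le_antisymm ?_ (hN₃ n m hN3 hm hmn)
  obtain ⟨A, hA, hmA, hAc⟩ := exists_card_eq_maxAvoiding (n := n) hm
  by_contra! hlt
  rw [← hAc] at hlt
  refine hmA (hN₁ n m hN1 hm ?_ (by linarith) A hA hlt ?_)
  · refine le_trans ?_ hlow
    gcongr
    exact le_max_left _ _
  · have h1 := le_card_mul_of_sBound_lt hm hlt
    have h2 : (n : ℝ) ≤ A.card * (2.39 * L) := by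
      have : (n : ℝ) ≤ A.card * smallestNonDivisor m := by exact_mod_cast h1
      exact this.trans (by gcongr)
    rw [le_div_iff₀ (by positivity)] at hup
    have h3 : ((1 + 0.02) * √(2 * (m : ℝ))) ^ 2 ≤ (A.card : ℝ) ^ 2 := by
      rw [mul_pow, Real.sq_sqrt (by positivity)]
      have h4 : (n : ℝ) ^ 2 ≤ (A.card * (2.39 * L)) ^ 2 := by gcongr
      -- 5.7121 = 2.39², and 1.02² · 5.7121 < 6 is what the constant 12 permits.
      have h5 : (m : ℝ) * 12 * L ^ 2 ≤ (A.card : ℝ) ^ 2 * 5.7121 * L ^ 2 := by nlinarith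
      have h6 := le_of_mul_le_mul_right h5 (by positivity)
      have h7 : (0 : ℝ) ≤ m := by positivity
      norm_num at h6 ⊢
      linarith
    exact (sq_le_sq₀ (by positivity) (by positivity)).1 h3

theorem exists_forall_maxAvoiding_eq_max {ε : ℝ} (hε : 0 < ε) :
    ∃ N : ℕ, 2 ≤ N ∧ ∀ n m : ℕ, N ≤ n → 0 < m →
      (n : ℝ) ^ 2 / (12 * Real.log (n : ℝ) ^ 2) ≤ (m : ℝ) →
      m ≤ (n + 1).choose 2 →
      ∃ δ : ℝ, |δ| ≤ ε ∧
        (maxAvoiding n m : ℝ) = max (sBound n m : ℝ) ((1 + δ) * √(2 * (m : ℝ))) := by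
  obtain ⟨C, hC0, N₁, hN₁⟩ := exists_forall_mem_subsetSums (η := min ε 1)
    (lt_min hε one_pos) (min_le_right _ _)
  obtain ⟨N₂, hN₂⟩ := exists_smallestNonDivisor_le_log_of_le_sq
  obtain ⟨N₃, hN₃⟩ := exists_forall_sBound_le_maxAvoiding
  obtain ⟨N₄, hN₄3, hN₄⟩ := exists_forall_log_pow_le (12 * C + 8 / ε)
  refine ⟨max N₄ (max N₁ (max N₂ N₃)), by have := le_max_left N₄ (max N₁ (max N₂ N₃)); omega, ?_⟩
  intro n m hn hm hlow hup
  simp only [max_le_iff] at hn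
  obtain ⟨hn4, hn1, hn2, hn3⟩ := hn
  obtain ⟨hL1, -, hL⟩ := hN₄ n hn4
  set L := Real.log n with hLdef
  have hn0 : (0 : ℝ) < n := by
    have : 0 < n := by omega
    exact_mod_cast this
  have hup2 : 2 * m ≤ n * (n + 1) := by
    rw [Nat.choose_two_right, Nat.add_sub_cancel] at hup
    have := Nat.div_mul_le_self ((n + 1) * n) 2
    nlinarith
  have hmn : (m : ℝ) ≤ (n : ℝ) ^ 2 := by
    have : m ≤ n ^ 2 := by nlinarith
    exact_mod_cast this
  have hs := hN₂ n m hn2 hm hmn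
  have hL34 : L ^ 3 ≤ L ^ 4 := pow_le_pow_right₀ hL1 (by norm_num)
  have hL14 : L ≤ L ^ 4 := le_self_pow₀ hL1 (by norm_num)
  have hε8 : 0 < 8 / ε := by positivity
  have hL4 : 0 < L ^ 4 := by positivity
  have hmC : C * n * L ≤ m := by
    refine le_trans ?_ hlow
    rw [le_div_iff₀ (by positivity)]
    have h1 : 12 * C * L ^ 3 ≤ n := by nlinarith
    calc C * n * L * (12 * L ^ 2) = 12 * C * L ^ 3 * (n : ℝ) := by ring
      _ ≤ n * (n : ℝ) := by gcongr
      _ = (n : ℝ) ^ 2 := by ring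
  have hr0 : 0 < √(2 * (m : ℝ)) := Real.sqrt_pos.2 (by positivity)
  have hrε : 2 ≤ ε * √(2 * (m : ℝ)) := by
    rw [div_le_iff₀ (by positivity)] at hlow
    have h1 : 8 / ε * L ≤ n := by nlinarith
    have h2 : (8 / ε * L) ^ 2 ≤ (n : ℝ) ^ 2 := by gcongr
    have h3 : (2 / ε) ^ 2 ≤ 2 * (m : ℝ) := by
      have h4 : (2 / ε) ^ 2 * L ^ 2 ≤ 2 * m * L ^ 2 := by
        have : (8 / ε * L) ^ 2 = 16 * ((2 / ε) ^ 2 * L ^ 2) := by ring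
        have h7 : 0 ≤ (m : ℝ) * L ^ 2 := by positivity
        linarith
      exact le_of_mul_le_mul_right h4 (by positivity)
    have h5 := Real.le_sqrt_of_sq_le h3
    rwa [div_le_iff₀' hε] at h5
  have hlower : (1 - ε) * √(2 * (m : ℝ)) ≤ maxAvoiding n m := by
    have hk1 : 0 < Nat.sqrt (2 * m) := Nat.sqrt_pos.2 (by omega)
    have hk2 : Nat.sqrt (2 * m) * Nat.sqrt (2 * m) ≤ 2 * m := Nat.sqrt_le _
    have h1 := le_maxAvoiding_of_sum_lt (n := n) (m := m) (k := Nat.sqrt (2 * m) - 1)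
      (by
        by_contra! h
        have : (n + 1) * (n + 1) ≤ Nat.sqrt (2 * m) * Nat.sqrt (2 * m) :=
          Nat.mul_le_mul (by omega) (by omega)
        nlinarith)
      (by
        obtain ⟨k, hk⟩ := Nat.exists_eq_succ_of_ne_zero hk1.ne'
        rw [hk] at hk2 ⊢
        simp only [Nat.succ_eq_add_one, Nat.add_sub_cancel] at hk2 ⊢
        nlinarith)
    have h2 : √(2 * (m : ℝ)) ≤ Nat.sqrt (2 * m) + 1 := by
      have := Real.real_sqrt_le_nat_sqrt_succ (a := 2 * m)
      push_cast at this
      exact this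
    have h3 : (Nat.sqrt (2 * m) : ℝ) ≤ maxAvoiding n m + 1 := by
      have : Nat.sqrt (2 * m) ≤ maxAvoiding n m + 1 := by omega
      exact_mod_cast this
    linarith
  rcases (hN₃ n m hn3 hm hmn).eq_or_lt with heq | hlt
  -- When s(n,m) is attained, δ only has to keep the second term below it.
  · refine ⟨-ε, by rw [abs_neg, abs_of_pos hε], ?_⟩
    rw [heq, max_eq_left]
    linarith
  · have hupper : (maxAvoiding n m : ℝ) < (1 + ε) * √(2 * (m : ℝ)) := by
      obtain ⟨A, hA, hmA, hAc⟩ := exists_card_eq_maxAvoiding (n := n) hm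
      by_contra! h
      rw [← hAc] at hlt h
      refine hmA (hN₁ n m hn1 hm hmC (by linarith) A hA hlt (le_trans ?_ h))
      gcongr
      exact min_le_left _ _
    refine ⟨maxAvoiding n m / √(2 * (m : ℝ)) - 1, ?_, ?_⟩
    · rw [abs_le]
      constructor
      · rw [le_sub_iff_add_le, le_div_iff₀ hr0]
        linarith
      · rw [sub_le_iff_le_add, div_le_iff₀ hr0]
        linarith
    · rw [add_sub_cancel, div_mul_cancel₀ _ hr0.ne', max_eq_right]
      exact_mod_cast hlt.le

theorem mainTheorem9 :
    (∃ C : ℝ, 0 < C ∧ ∀ n m : ℕ, 2 ≤ n → 0 < m →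
      C * (n : ℝ) * Real.log (n : ℝ) ≤ (m : ℝ) →
      (m : ℝ) ≤ (n : ℝ) ^ 2 / (12 * Real.log (n : ℝ) ^ 2) →
      maxAvoiding n m = sBound n m) ∧
    (∀ ε : ℝ, 0 < ε → ∃ N : ℕ, 2 ≤ N ∧ ∀ n m : ℕ, N ≤ n → 0 < m →
      (n : ℝ) ^ 2 / (12 * Real.log (n : ℝ) ^ 2) ≤ (m : ℝ) →
      m ≤ (n + 1).choose 2 →
      ∃ δ : ℝ, |δ| ≤ ε ∧
        (maxAvoiding n m : ℝ) = max (sBound n m : ℝ) ((1 + δ) * √(2 * (m : ℝ)))) :=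
  ⟨exists_forall_maxAvoiding_eq_sBound, fun _ hε => exists_forall_maxAvoiding_eq_max hε⟩

end Main
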